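/- Let $M$ be a 4-dimensional smooth (Hausdorff) manifold without boundary, equipped with a smooth metric tensor field $g$ of Lorentzian signature $(-,+,+,+)$ and a time orientation. A tangent vector $v$ is timelike if $g(v,v)<0$, and lightlike if $v\neq 0$ and $g(v,v)=0$. Let $\gamma : I \to M$ be a clock, i.e. a smooth embedding of a non-degenerate real interval $I$ into $M$ whose tangent vector $\dot\gamma(t)$ is timelike and future-pointing for every $t\in I$. Let $t_0$ be an interior point of $I$ and $p=\gamma(t_0)$. Then there are open subsets $U$ and $V$ of $M$ with $p\in U\subset V$ such that every point $q\in U\setminus\gamma(I)$ can be connected to $\gamma(I)$ by precisely one future-pointing and by precisely one past-pointing light ray that stays within $V$. (In this case $U$ is called a radar neighborhood of $p$ with respect to $\gamma$.) Here a future-pointing (past-pointing) light ray connecting $q$ to $\gamma(I)$ within $V$ is a geodesic segment $c:[0,1]\to V$ of $g$, affinely parametrized, with $c(0)=q$, $c(1)\in\gamma(I)$ and $\dot c(s)$ lightlike and future-pointing (past-pointing) for all $s\in[0,1]$. (Fixing the parameter interval $[0,1]$ removes the freedom of affine reparametrization.) -/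

import Mathlib

open scoped Manifold ContDiff Topology
open Bundle

/-- A smooth Lorentzian metric of signature `(-,+,+,+)` on a 4-dimensional manifold. -/
structure LorentzMetric (M : Type*) [TopologicalSpace M]
    [ChartedSpace (EuclideanSpace ℝ (Fin 4)) M] [IsManifold (𝓡 4) ∞ M] where
  /-- the bilinear form on each tangent space -/
  val : ∀ x : M, TangentSpace (𝓡 4) x →L[ℝ] TangentSpace (𝓡 4) x →L[ℝ] ℝ
  symm : ∀ (x : M) (v w : TangentSpace (𝓡 4) x), val x v w = val x w v
  /-- every tangent space has a basis in which the form is `diag(-1, 1, 1, 1)` -/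
  lorentzian : ∀ x : M, ∃ b : Module.Basis (Fin 4) ℝ (TangentSpace (𝓡 4) x), ∀ i j : Fin 4,
    val x (b i) (b j) = if i = j then (if i = 0 then -1 else 1) else 0
  /-- the form is a smooth section of the bundle of bilinear forms on the tangent bundle -/
  smooth : ContMDiff (𝓡 4)
    ((𝓡 4).prod 𝓘(ℝ, EuclideanSpace ℝ (Fin 4) →L[ℝ] EuclideanSpace ℝ (Fin 4) →L[ℝ] ℝ)) ∞
    (fun x : M ↦ TotalSpace.mk'
      (EuclideanSpace ℝ (Fin 4) →L[ℝ] EuclideanSpace ℝ (Fin 4) →L[ℝ] ℝ)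
      (E := fun x : M ↦ TangentSpace (𝓡 4) x →L[ℝ] TangentSpace (𝓡 4) x →L[ℝ] ℝ) x (val x))

section

variable {M : Type*} [TopologicalSpace M] [ChartedSpace (EuclideanSpace ℝ (Fin 4)) M]
  [IsManifold (𝓡 4) ∞ M]

/-- A tangent vector `v` is timelike if `g(v,v) < 0`. -/
def LorentzMetric.Timelike (g : LorentzMetric M) {x : M} (v : TangentSpace (𝓡 4) x) : Prop :=
  g.val x v v < 0

/-- A tangent vector `v` is lightlike if `v ≠ 0` and `g(v,v) = 0`. -/
def LorentzMetric.Lightlike (g : LorentzMetric M) {x : M} (v : TangentSpace (𝓡 4) x) : Prop :=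
  v ≠ 0 ∧ g.val x v v = 0

/-- A time orientation: a choice, in each tangent space, of one of the two cones of timelike
vectors as the future cone, which is consistent in the sense that near each point there is a
continuous vector field with values in the chosen cones. -/
structure TimeOrientation (g : LorentzMetric M) where
  /-- the set of future-pointing timelike vectors at each point -/
  futureCone : ∀ x : M, Set (TangentSpace (𝓡 4) x)
  isTimecone : ∀ x : M, ∃ u : TangentSpace (𝓡 4) x, g.Timelike u ∧
    futureCone x = {v | g.Timelike v ∧ g.val x u v < 0}
  consistent : ∀ x : M, ∃ W ∈ 𝓝 x, ∃ X : ∀ y : M, TangentSpace (𝓡 4) y,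
    ContinuousOn (fun y : M ↦ (⟨y, X y⟩ : TangentBundle (𝓡 4) M)) W ∧ ∀ y ∈ W, X y ∈ futureCone y

/-- A nonzero causal (timelike or lightlike) vector is future-pointing if it has negative scalar
product with the vectors of the future cone, i.e. if it lies in the closure of that cone. -/
def TimeOrientation.FuturePointing {g : LorentzMetric M} (τ : TimeOrientation g) {x : M}
    (v : TangentSpace (𝓡 4) x) : Prop :=
  v ≠ 0 ∧ g.val x v v ≤ 0 ∧ ∀ u ∈ τ.futureCone x, g.val x u v < 0

/-- A vector `v` is past-pointing if `-v` is future-pointing. -/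
def TimeOrientation.PastPointing {g : LorentzMetric M} (τ : TimeOrientation g) {x : M}
    (v : TangentSpace (𝓡 4) x) : Prop :=
  τ.FuturePointing (-v)

/-- The velocity at parameter value `s` of a curve `c` defined on the interval `J`. -/
noncomputable def velocity (c : ℝ → M) (J : Set ℝ) (s : ℝ) : TangentSpace (𝓡 4) (c s) :=
  mfderivWithin 𝓘(ℝ, ℝ) (𝓡 4) c J s (1 : ℝ)

/-- A clock with parameter interval `I`: a smooth embedding of `I` into `M` whose velocity is
everywhere timelike and future-pointing. (Such a curve is an immersion because a timelike vector is
nonzero.) The values of `γ` outside `I` are irrelevant. -/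
structure IsClock {g : LorentzMetric M} (τ : TimeOrientation g) (I : Set ℝ) (γ : ℝ → M) :
    Prop where
  interval : I.OrdConnected
  nondegenerate : I.Nontrivial
  smooth : ContMDiffOn 𝓘(ℝ, ℝ) (𝓡 4) ∞ γ I
  embedding : Topology.IsEmbedding (fun t : I ↦ γ t)
  timelike : ∀ t ∈ I, g.Timelike (velocity γ I t)
  futurePointing : ∀ t ∈ I, τ.FuturePointing (velocity γ I t)

/-- The metric in the chart around `x₀`: the value on `v, w` of the metric coefficients at the
coordinate point `y`. -/
noncomputable def LorentzMetric.inChart (g : LorentzMetric M) (x₀ : M)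
    (y v w : EuclideanSpace ℝ (Fin 4)) : ℝ :=
  g.val ((extChartAt (𝓡 4) x₀).symm y)
    (mfderiv 𝓘(ℝ, EuclideanSpace ℝ (Fin 4)) (𝓡 4) (extChartAt (𝓡 4) x₀).symm y v)
    (mfderiv 𝓘(ℝ, EuclideanSpace ℝ (Fin 4)) (𝓡 4) (extChartAt (𝓡 4) x₀).symm y w)

/-- The Christoffel symbols of the first kind in the chart around `x₀`, contracted with constant
vectors: `Γ(a, b; w) = ½ (∂ₐ g(b,w) + ∂_b g(a,w) - ∂_w g(a,b))`. -/
noncomputable def LorentzMetric.christoffel (g : LorentzMetric M) (x₀ : M)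
    (y a b w : EuclideanSpace ℝ (Fin 4)) : ℝ :=
  (fderiv ℝ (fun z ↦ g.inChart x₀ z b w) y a + fderiv ℝ (fun z ↦ g.inChart x₀ z a w) y b
    - fderiv ℝ (fun z ↦ g.inChart x₀ z a b) y w) / 2

/-- `c` is an (affinely parametrized) geodesic on the interval `J`: in the chart around any point,
`u = φ ∘ c` satisfies the geodesic equation `g_{lk} u''^k + Γ_{l,ij} u'^i u'^j = 0`. Solutions of
class `C²` are automatically smooth. -/
def LorentzMetric.IsGeodesicOn (g : LorentzMetric M) (c : ℝ → M) (J : Set ℝ) : Prop :=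
  ContMDiffOn 𝓘(ℝ, ℝ) (𝓡 4) 2 c J ∧
  ∀ x₀ : M, ∀ s ∈ J, c s ∈ (extChartAt (𝓡 4) x₀).source →
    let u : ℝ → EuclideanSpace ℝ (Fin 4) := fun r ↦ extChartAt (𝓡 4) x₀ (c r)
    let u' : ℝ → EuclideanSpace ℝ (Fin 4) := derivWithin u J
    let u'' : ℝ → EuclideanSpace ℝ (Fin 4) := derivWithin u' J
    ∀ w : EuclideanSpace ℝ (Fin 4),
      g.inChart x₀ (u s) (u'' s) w + g.christoffel x₀ (u s) (u' s) (u' s) w = 0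

/-- `c`, restricted to `[0,1]`, is a lightlike geodesic segment from the point `q` to a point of
the set `S` that stays within `V`. Every geodesic segment has exactly one orientation-preserving
affine parametrization by `[0,1]`. -/
structure LorentzMetric.IsLightRayWithin (g : LorentzMetric M) (V : Set M) (q : M) (S : Set M)
    (c : ℝ → M) : Prop where
  geodesic : g.IsGeodesicOn c (Set.Icc 0 1)
  lightlike : ∀ s ∈ Set.Icc (0 : ℝ) 1, g.Lightlike (velocity c (Set.Icc 0 1) s)
  start : c 0 = q
  finish : c 1 ∈ S
  stays : ∀ s ∈ Set.Icc (0 : ℝ) 1, c s ∈ V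

/-- `c` is a future-pointing light ray from `q` to `S` within `V`. -/
def TimeOrientation.IsFutureLightRay {g : LorentzMetric M} (τ : TimeOrientation g) (V : Set M)
    (q : M) (S : Set M) (c : ℝ → M) : Prop :=
  g.IsLightRayWithin V q S c ∧
    ∀ s ∈ Set.Icc (0 : ℝ) 1, τ.FuturePointing (velocity c (Set.Icc 0 1) s)

/-- `c` is a past-pointing light ray from `q` to `S` within `V`. -/
def TimeOrientation.IsPastLightRay {g : LorentzMetric M} (τ : TimeOrientation g) (V : Set M)
    (q : M) (S : Set M) (c : ℝ → M) : Prop :=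
  g.IsLightRayWithin V q S c ∧
    ∀ s ∈ Set.Icc (0 : ℝ) 1, τ.PastPointing (velocity c (Set.Icc 0 1) s)

end

/-! In a chart, geodesics are the solutions of `u'' = A(u)(u', u')` with a smooth field `A` of
quadratic forms. For short geodesics issuing from `q` the map from initial velocities to endpoints
is close to `v ↦ q + v`, so each point `β t` of the curve is the endpoint of one short geodesic
from `q`, with initial velocity `v t`, and the difference `v t' - v t` is close to `(t' - t) • T`,
where the timelike vector `T` is the coordinate velocity of the curve. Since a future-pointing
causal vector plus a future-pointing timelike one is timelike, `v t` is future-pointing and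
lightlike for at most one `t`; the intermediate value theorem applied to the square of `v t`
produces such a `t`. That a ray need not be short a priori is dealt with by the functional
`-g(T, ·)`, which bounds the norm of future-pointing causal vectors and, along a ray, varies by at
most a bounded factor, so that a ray in a small ball has small velocity. The past-pointing rays are
obtained by running through the curve backwards. -/

section

set_option maxSynthPendingDepth 3

open Set Metric

section Spray

variable {E : Type*} [NormedAddCommGroup E] [NormedSpace ℝ E] {A : E → E →L[ℝ] E →L[ℝ] E}

/-- `u`, with velocity `w`, solves the second order equation `u'' = A(u)(u', u')` on `J`: an
integral curve of the spray with coefficients `A`. The geodesic equation in a chart has this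
form. -/
structure IsSpraySolution (A : E → E →L[ℝ] E →L[ℝ] E) (J : Set ℝ) (u w : ℝ → E) : Prop where
  pos : ∀ s ∈ J, HasDerivWithinAt u (w s) J s
  vel : ∀ s ∈ J, HasDerivWithinAt w (A (u s) (w s) (w s)) J s

namespace IsSpraySolution

theorem const (A : E → E →L[ℝ] E →L[ℝ] E) (J : Set ℝ) (q : E) :
    IsSpraySolution A J (fun _ ↦ q) (fun _ ↦ 0) where
  pos s _ := hasDerivWithinAt_const s _ q
  vel s _ := by simpa using hasDerivWithinAt_const s J (0 : E)

theorem comp_mul {J J' : Set ℝ} {u w : ℝ → E} (h : IsSpraySolution A J u w) {T : ℝ}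
    (hT : MapsTo (T * ·) J' J) :
    IsSpraySolution A J' (fun s ↦ u (T * s)) (fun s ↦ T • w (T * s)) := by
  have hmul : ∀ s, HasDerivWithinAt (T * ·) T J' s := fun s ↦ by
    simpa using (hasDerivWithinAt_id s J').const_mul T
  refine ⟨fun s hs ↦ (h.pos _ (hT hs)).scomp s (hmul s) hT, fun s hs ↦ ?_⟩
  simpa [Function.comp_def, Pi.smul_def] using ((h.vel _ (hT hs)).scomp s (hmul s) hT).const_smul T

theorem contDiffOn_two {J : Set ℝ} {u w : ℝ → E} (h : IsSpraySolution A J u w)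
    (hJ : UniqueDiffOn ℝ J) (hA : ContinuousOn (fun s ↦ A (u s)) J) : ContDiffOn ℝ 2 u J := by
  have hw : ContinuousOn w J := fun s hs ↦ (h.vel s hs).continuousWithinAt
  have hw1 : ContDiffOn ℝ 1 w J := by
    rw [show (1 : WithTop ℕ∞) = 0 + 1 by norm_num, contDiffOn_succ_iff_derivWithin hJ]
    refine ⟨fun s hs ↦ (h.vel s hs).differentiableWithinAt, by simp, ?_⟩
    exact contDiffOn_zero.2 (((hA.clm_apply hw).clm_apply hw).congr fun s hs ↦
      (h.vel s hs).derivWithin (hJ s hs))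
  rw [show (2 : WithTop ℕ∞) = 1 + 1 by norm_num, contDiffOn_succ_iff_derivWithin hJ]
  exact ⟨fun s hs ↦ (h.pos s hs).differentiableWithinAt, by simp,
    hw1.congr fun s hs ↦ (h.pos s hs).derivWithin (hJ s hs)⟩

end IsSpraySolution

/-- A short solution: it is defined on `[0,1]`, and both its distance from `x₀` and its velocity
remain below `ρ`. -/
structure IsSpraySolutionIn (A : E → E →L[ℝ] E →L[ℝ] E) (x₀ : E) (ρ : ℝ) (u w : ℝ → E) : Prop
    extends IsSpraySolution A (Icc 0 1) u w where
  pos_mem : ∀ s ∈ Icc (0 : ℝ) 1, u s ∈ ball x₀ ρ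
  vel_mem : ∀ s ∈ Icc (0 : ℝ) 1, w s ∈ ball 0 ρ

/-- The acceleration `A(y)(w, w)` is `κ`-Lipschitz in `(y, w)` for `y` within `ρ` of `x₀` and `w`
of norm less than `ρ`. -/
def IsSprayLipschitz (A : E → E →L[ℝ] E →L[ℝ] E) (x₀ : E) (ρ κ : ℝ) : Prop :=
  ∀ y₁ ∈ ball x₀ ρ, ∀ y₂ ∈ ball x₀ ρ, ∀ w₁ ∈ ball (0 : E) ρ, ∀ w₂ ∈ ball (0 : E) ρ,
    ‖A y₁ w₁ w₁ - A y₂ w₂ w₂‖ ≤ κ * max ‖y₁ - y₂‖ ‖w₁ - w₂‖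

variable {x₀ : E} {ρ κ : ℝ} {u w u₁ w₁ u₂ w₂ : ℝ → E}

theorem IsSpraySolutionIn.mono {ρ' : ℝ} (h : IsSpraySolutionIn A x₀ ρ u w) (hρ : ρ ≤ ρ') :
    IsSpraySolutionIn A x₀ ρ' u w :=
  ⟨h.1, fun s hs ↦ ball_subset_ball hρ (h.pos_mem s hs),
    fun s hs ↦ ball_subset_ball hρ (h.vel_mem s hs)⟩

theorem IsSpraySolutionIn.const_pos_zero (h : IsSpraySolutionIn A x₀ ρ u w) :
    IsSpraySolutionIn A x₀ ρ (fun _ ↦ u 0) (fun _ ↦ 0) where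
  __ := IsSpraySolution.const A _ (u 0)
  pos_mem _ _ := h.pos_mem 0 (by simp)
  vel_mem _ _ := mem_ball_self (pos_of_mem_ball (h.pos_mem 0 (by simp)))

theorem IsSprayLipschitz.mono {ρ' κ' : ℝ} (h : IsSprayLipschitz A x₀ ρ κ) (hρ : ρ' ≤ ρ)
    (hκ : κ ≤ κ') : IsSprayLipschitz A x₀ ρ' κ' := fun y₁ hy₁ y₂ hy₂ w₁ hw₁ w₂ hw₂ ↦
  (h y₁ (ball_subset_ball hρ hy₁) y₂ (ball_subset_ball hρ hy₂) w₁ (ball_subset_ball hρ hw₁) w₂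
    (ball_subset_ball hρ hw₂)).trans (by gcongr)

theorem exists_isSprayLipschitz (hA : ContDiffAt ℝ 1 A x₀) (hκ : 0 < κ) :
    ∃ ρ > 0, IsSprayLipschitz A x₀ ρ κ := by
  have hA₁ : ContDiffAt ℝ 1 (fun z : E × E ↦ A z.1) (x₀, 0) :=
    ContDiffAt.comp (g := A) (x₀, (0 : E)) hA contDiffAt_fst
  have hquad : ContDiffAt ℝ 1 (fun z : E × E ↦ A z.1 z.2 z.2) (x₀, 0) :=
    (hA₁.clm_apply contDiffAt_snd).clm_apply contDiffAt_snd
  -- the derivative at `(x₀, 0)` vanishes because `A(y)(w, w)` is quadratic in `w`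
  have hderiv : HasFDerivAt (fun z : E × E ↦ A z.1 z.2 z.2) (0 : E × E →L[ℝ] E) (x₀, 0) := by
    have hsnd : HasFDerivAt (fun z : E × E ↦ z.2) (.snd ℝ E E) (x₀, (0 : E)) := hasFDerivAt_snd
    refine (((hA₁.differentiableAt one_ne_zero).hasFDerivAt.clm_apply hsnd).clm_apply
      hsnd).congr_fderiv (ContinuousLinearMap.ext fun z ↦ ?_)
    simp
  obtain ⟨ρ, hρ, hlip⟩ := Metric.eventually_nhds_iff.1
    ((hquad.hasStrictFDerivAt' hderiv one_ne_zero).isLittleO.def hκ)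
  refine ⟨ρ, hρ, fun y₁ hy₁ y₂ hy₂ w₁ hw₁ w₂ hw₂ ↦ ?_⟩
  have hdist : dist ((y₁, w₁), (y₂, w₂)) ((x₀, 0), (x₀, 0)) < ρ := by
    simp only [Prod.dist_eq, sup_lt_iff]
    exact ⟨⟨hy₁, hw₁⟩, ⟨hy₂, hw₂⟩⟩
  simpa [Prod.norm_def] using hlip hdist

theorem norm_sub_zero_le_of_norm_hasDerivWithin_le {f f' : ℝ → E} {C : ℝ}
    (hf : ∀ s ∈ Icc (0 : ℝ) 1, HasDerivWithinAt f (f' s) (Icc 0 1) s)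
    (hC : ∀ s ∈ Icc (0 : ℝ) 1, ‖f' s‖ ≤ C) {s : ℝ} (hs : s ∈ Icc (0 : ℝ) 1) :
    ‖f s - f 0‖ ≤ C := by
  have hC0 : 0 ≤ C := (norm_nonneg _).trans (hC s hs)
  calc ‖f s - f 0‖ ≤ C * ‖s - 0‖ :=
        (convex_Icc (0 : ℝ) 1).norm_image_sub_le_of_norm_hasDerivWithin_le hf hC (by simp) hs
    _ ≤ C := by
      rw [sub_zero, Real.norm_of_nonneg hs.1]
      exact mul_le_of_le_one_right hC0 hs.2

namespace IsSpraySolutionIn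

theorem norm_vel_sub_sub_le (h₁ : IsSpraySolutionIn A x₀ ρ u₁ w₁)
    (h₂ : IsSpraySolutionIn A x₀ ρ u₂ w₂) (hA : IsSprayLipschitz A x₀ ρ κ) (hκ₀ : 0 ≤ κ)
    (hκ : κ ≤ 1 / 2) (h0 : u₁ 0 = u₂ 0) {s : ℝ} (hs : s ∈ Icc (0 : ℝ) 1) :
    ‖w₁ s - w₂ s - (w₁ 0 - w₂ 0)‖ ≤ 2 * κ * ‖w₁ 0 - w₂ 0‖ := by
  have hcont : ContinuousOn (fun s ↦ ‖w₁ s - w₂ s‖) (Icc 0 1) := fun s hs ↦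
    ((h₁.vel s hs).continuousWithinAt.sub (h₂.vel s hs).continuousWithinAt).norm
  obtain ⟨m, hm, hmax⟩ := isCompact_Icc.exists_isMaxOn (nonempty_Icc.2 zero_le_one) hcont
  have hpos : ∀ s ∈ Icc (0 : ℝ) 1, ‖u₁ s - u₂ s‖ ≤ ‖w₁ m - w₂ m‖ := fun s hs ↦ by
    simpa [h0] using norm_sub_zero_le_of_norm_hasDerivWithin_le
      (fun s hs ↦ (h₁.pos s hs).sub (h₂.pos s hs)) hmax hs
  have hvel : ∀ s ∈ Icc (0 : ℝ) 1, ‖w₁ s - w₂ s - (w₁ 0 - w₂ 0)‖ ≤ κ * ‖w₁ m - w₂ m‖ :=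
    fun s hs ↦ norm_sub_zero_le_of_norm_hasDerivWithin_le
      (fun s hs ↦ (h₁.vel s hs).sub (h₂.vel s hs)) (fun s hs ↦
        (hA _ (h₁.pos_mem s hs) _ (h₂.pos_mem s hs) _ (h₁.vel_mem s hs) _ (h₂.vel_mem s hs)).trans
          (by gcongr; exact max_le (hpos s hs) (hmax hs))) hs
  have hmax_le : ‖w₁ m - w₂ m‖ ≤ 2 * ‖w₁ 0 - w₂ 0‖ := by
    have hhalf : κ * ‖w₁ m - w₂ m‖ ≤ 1 / 2 * ‖w₁ m - w₂ m‖ := by gcongr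
    linarith [hvel m hm, norm_sub_norm_le (w₁ m - w₂ m) (w₁ 0 - w₂ 0)]
  calc ‖w₁ s - w₂ s - (w₁ 0 - w₂ 0)‖ ≤ κ * ‖w₁ m - w₂ m‖ := hvel s hs
    _ ≤ κ * (2 * ‖w₁ 0 - w₂ 0‖) := by gcongr
    _ = 2 * κ * ‖w₁ 0 - w₂ 0‖ := by ring

theorem norm_pos_sub_sub_le (h₁ : IsSpraySolutionIn A x₀ ρ u₁ w₁)
    (h₂ : IsSpraySolutionIn A x₀ ρ u₂ w₂) (hA : IsSprayLipschitz A x₀ ρ κ) (hκ₀ : 0 ≤ κ)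
    (hκ : κ ≤ 1 / 2) (h0 : u₁ 0 = u₂ 0) :
    ‖u₁ 1 - u₂ 1 - (w₁ 0 - w₂ 0)‖ ≤ 2 * κ * ‖w₁ 0 - w₂ 0‖ := by
  have hder : ∀ s ∈ Icc (0 : ℝ) 1, HasDerivWithinAt (fun s ↦ u₁ s - u₂ s - s • (w₁ 0 - w₂ 0))
      (w₁ s - w₂ s - (w₁ 0 - w₂ 0)) (Icc 0 1) s := fun s hs ↦
    ((h₁.pos s hs).sub (h₂.pos s hs)).sub
      (by simpa using (hasDerivWithinAt_id s (Icc (0 : ℝ) 1)).smul_const (w₁ 0 - w₂ 0))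
  simpa [h0] using norm_sub_zero_le_of_norm_hasDerivWithin_le hder
    (fun s hs ↦ h₁.norm_vel_sub_sub_le h₂ hA hκ₀ hκ h0 hs) (right_mem_Icc.2 zero_le_one)

theorem norm_vel_sub_le (h₁ : IsSpraySolutionIn A x₀ ρ u₁ w₁)
    (h₂ : IsSpraySolutionIn A x₀ ρ u₂ w₂) (hA : IsSprayLipschitz A x₀ ρ (1 / 4))
    (h0 : u₁ 0 = u₂ 0) : ‖w₁ 0 - w₂ 0‖ ≤ 2 * ‖u₁ 1 - u₂ 1‖ := by
  linarith [h₁.norm_pos_sub_sub_le h₂ hA (by norm_num) (by norm_num) h0,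
    norm_sub_norm_le (w₁ 0 - w₂ 0) (u₁ 1 - u₂ 1), norm_sub_rev (w₁ 0 - w₂ 0) (u₁ 1 - u₂ 1)]

theorem eqOn_of_endpoints_eq (h₁ : IsSpraySolutionIn A x₀ ρ u₁ w₁)
    (h₂ : IsSpraySolutionIn A x₀ ρ u₂ w₂) (hA : IsSprayLipschitz A x₀ ρ (1 / 4))
    (h0 : u₁ 0 = u₂ 0) (h1 : u₁ 1 = u₂ 1) : EqOn u₁ u₂ (Icc 0 1) := by
  have hw0 : ‖w₁ 0 - w₂ 0‖ = 0 := by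
    simpa [h1] using h₁.norm_vel_sub_le h₂ hA h0
  have hw : ∀ s ∈ Icc (0 : ℝ) 1, ‖w₁ s - w₂ s‖ ≤ 0 := fun s hs ↦ by
    simpa [hw0, norm_eq_zero.1 hw0] using
      h₁.norm_vel_sub_sub_le h₂ hA (by norm_num) (by norm_num) h0 hs
  intro s hs
  have hu := norm_sub_zero_le_of_norm_hasDerivWithin_le
    (fun s hs ↦ (h₁.pos s hs).sub (h₂.pos s hs)) hw hs
  simpa [h0, sub_eq_zero] using hu

theorem vel_ne_zero (h : IsSpraySolutionIn A x₀ ρ u w) (hA : IsSprayLipschitz A x₀ ρ (1 / 4))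
    (h0 : w 0 ≠ 0) {s : ℝ} (hs : s ∈ Icc (0 : ℝ) 1) : w s ≠ 0 := by
  intro hws
  have hle : ‖w 0‖ ≤ 2 * (1 / 4) * ‖w 0‖ := by
    simpa [hws] using
      h.norm_vel_sub_sub_le h.const_pos_zero hA (by norm_num) (by norm_num) rfl hs
  linarith [norm_pos_iff.2 h0]

theorem apply_one_eq_of_vel_eq_zero (h : IsSpraySolutionIn A x₀ ρ u w)
    (hA : IsSprayLipschitz A x₀ ρ (1 / 4)) (h0 : w 0 = 0) : u 1 = u 0 := by
  simpa [h0, sub_eq_zero] using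
    h.norm_pos_sub_sub_le h.const_pos_zero hA (by norm_num) (by norm_num) rfl

end IsSpraySolutionIn

theorem exists_forall_mem_ball_hasDerivWithinAt [CompleteSpace E] {F : E → E} {z₀ : E}
    (hF : ContDiffAt ℝ 1 F z₀) {r : ℝ} (hr : 0 < r) :
    ∃ δ > 0, ∃ T ∈ Ioc (0 : ℝ) 1, ∀ z ∈ ball z₀ δ, ∃ α : ℝ → E, α 0 = z ∧
      ∀ t ∈ Icc 0 T, HasDerivWithinAt α (F (α t)) (Icc 0 T) t ∧ α t ∈ ball z₀ r := by
  obtain ⟨ε, hε, a, b, L, K, hb, hpl⟩ := IsPicardLindelof.of_contDiffAt_one hF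
  obtain ⟨α, hα, hcont⟩ := (hpl 0).exists_forall_mem_closedBall_eq_hasDerivWithinAt_continuousOn
  have h0 : (z₀, (0 : ℝ)) ∈ closedBall z₀ b ×ˢ Icc (0 - ε) (0 + ε) :=
    ⟨mem_closedBall_self b.2, by simp [hε.le]⟩
  obtain ⟨η, hη, hnear⟩ := continuousWithinAt_iff.1 (hcont _ h0) r hr
  have hT : 0 < min (min ε 1) (η / 2) := by positivity
  refine ⟨min b η, lt_min hb hη, min (min ε 1) (η / 2), ⟨hT, by simp⟩, fun z hz ↦ ?_⟩
  have hzb : z ∈ closedBall z₀ b :=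
    ball_subset_closedBall (ball_subset_ball (min_le_left _ _) hz)
  have hsub : Icc 0 (min (min ε 1) (η / 2)) ⊆ Icc (0 - ε) (0 + ε) :=
    Icc_subset_Icc (by linarith) (by simp)
  refine ⟨fun t ↦ α (z, t), (hα z hzb).1, fun t ht ↦
    ⟨((hα z hzb).2 t (hsub ht)).mono hsub, ?_⟩⟩
  have htη : t < η := (ht.2.trans (min_le_right _ _)).trans_lt (half_lt_self hη)
  have hdist : dist (z, t) (z₀, 0) < η := by
    rw [Prod.dist_eq, sup_lt_iff, Real.dist_eq, sub_zero, abs_of_nonneg ht.1]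
    exact ⟨hz.trans_le (min_le_right _ _), htη⟩
  simpa [(hα z₀ h0.1).1] using hnear ⟨hzb, hsub ht⟩ hdist

theorem exists_forall_mem_ball_isSpraySolutionIn [CompleteSpace E] (hA : ContDiffAt ℝ 1 A x₀)
    (hρ : 0 < ρ) :
    ∃ δ > 0, ∀ q ∈ ball x₀ δ, ∀ v ∈ ball (0 : E) δ, ∃ u w : ℝ → E,
      IsSpraySolutionIn A x₀ ρ u w ∧ u 0 = q ∧ w 0 = v := by
  have hF : ContDiffAt ℝ 1 (fun z : E × E ↦ (z.2, A z.1 z.2 z.2)) (x₀, 0) :=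
    contDiffAt_snd.prodMk (((ContDiffAt.comp (g := A) (x₀, (0 : E)) hA contDiffAt_fst).clm_apply
      contDiffAt_snd).clm_apply contDiffAt_snd)
  obtain ⟨δ, hδ, T, ⟨hT₀, hT₁⟩, hflow⟩ := exists_forall_mem_ball_hasDerivWithinAt hF hρ
  refine ⟨δ * T, by positivity, fun q hq v hv ↦ ?_⟩
  -- the flow exists only up to time `T`: run it with velocity `v / T` and rescale time
  have hz : (q, T⁻¹ • v) ∈ ball (x₀, (0 : E)) δ := by
    rw [mem_ball, Prod.dist_eq, sup_lt_iff, dist_zero_right, norm_smul, norm_inv,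
      Real.norm_of_nonneg hT₀.le, inv_mul_lt_iff₀ hT₀, mul_comm]
    exact ⟨lt_of_lt_of_le hq (mul_le_of_le_one_right hδ.le hT₁), by simpa using hv⟩
  obtain ⟨α, hα₀, hα⟩ := hflow _ hz
  have hsol : IsSpraySolution A (Icc 0 T) (fun t ↦ (α t).1) (fun t ↦ (α t).2) :=
    ⟨fun t ht ↦ (hα t ht).1.fst, fun t ht ↦ (hα t ht).1.snd⟩
  have hmaps : MapsTo (T * ·) (Icc 0 1) (Icc 0 T) := fun s hs ↦
    ⟨mul_nonneg hT₀.le hs.1, mul_le_of_le_one_right hT₀.le hs.2⟩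
  have hmem : ∀ s ∈ Icc (0 : ℝ) 1,
      (α (T * s)).1 ∈ ball x₀ ρ ∧ (α (T * s)).2 ∈ ball (0 : E) ρ := fun s hs ↦ by
    simpa [Prod.dist_eq] using (hα _ (hmaps hs)).2
  refine ⟨_, _, ⟨hsol.comp_mul hmaps, fun s hs ↦ (hmem s hs).1, fun s hs ↦ ?_⟩, ?_, ?_⟩
  · rw [mem_ball_zero_iff, norm_smul, Real.norm_of_nonneg hT₀.le]
    exact (mul_le_of_le_one_left (norm_nonneg _) hT₁).trans_lt (mem_ball_zero_iff.1 (hmem s hs).2)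
  · simp [hα₀]
  · simp [hα₀, hT₀.ne']

theorem exists_mem_closedBall_eq_of_approx_id [CompleteSpace E] {Φ : E → E} {δ : ℝ} (hδ : 0 ≤ δ)
    (hΦ : ∀ v ∈ closedBall (0 : E) δ, ∀ v' ∈ closedBall (0 : E) δ,
      ‖Φ v - Φ v' - (v - v')‖ ≤ 1 / 2 * ‖v - v'‖)
    {x : E} (hx : ‖x - Φ 0‖ ≤ δ / 2) : ∃ v ∈ closedBall (0 : E) δ, Φ v = x := by
  let inv : (ContinuousLinearMap.id ℝ E).NonlinearRightInverse :=
    { toFun := id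
      nnnorm := 1
      bound' := fun y ↦ by simp
      right_inv' := fun y ↦ rfl }
  have happ : ApproximatesLinearOn Φ (ContinuousLinearMap.id ℝ E) (closedBall 0 δ) (1 / 2) :=
    fun v hv v' hv' ↦ by simpa using hΦ v hv v' hv'
  refine happ.surjOn_closedBall_of_nonlinearRightInverse inv hδ (b := 0) subset_rfl ?_
  rw [mem_closedBall_iff_norm]
  refine hx.trans_eq ?_
  simp only [inv, inv_one, NNReal.coe_one, NNReal.coe_div, NNReal.coe_ofNat]
  ring

theorem exists_forall_mem_ball_isSpraySolutionIn_joining [CompleteSpace E]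
    (hA : ContDiffAt ℝ 1 A x₀) (hlip : IsSprayLipschitz A x₀ ρ (1 / 4)) (hρ : 0 < ρ) :
    ∃ δ > 0, ∀ q ∈ ball x₀ δ, ∀ x ∈ ball x₀ δ, ∃ u w : ℝ → E,
      IsSpraySolutionIn A x₀ ρ u w ∧ u 0 = q ∧ u 1 = x := by
  obtain ⟨δ, hδ, hsol⟩ := exists_forall_mem_ball_isSpraySolutionIn hA hρ
  refine ⟨δ / 8, by positivity, fun q hq x hx ↦ ?_⟩
  choose! u w hsol hu0 hw0 using hsol q (ball_subset_ball (by linarith) hq)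
  have hball : closedBall (0 : E) (δ / 2) ⊆ ball 0 δ := closedBall_subset_ball (half_lt_self hδ)
  have hmem : (0 : E) ∈ ball (0 : E) δ := mem_ball_self hδ
  have hzero : u 0 1 = q :=
    ((hsol 0 hmem).apply_one_eq_of_vel_eq_zero hlip (hw0 0 hmem)).trans (hu0 0 hmem)
  have hclose : ‖x - u 0 1‖ ≤ δ / 2 / 2 := by
    rw [hzero, ← dist_eq_norm]
    linarith [dist_triangle_right x q x₀, mem_ball.1 hx, mem_ball.1 hq]
  obtain ⟨v, hv, hvx⟩ := exists_mem_closedBall_eq_of_approx_id (Φ := fun v ↦ u v 1)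
    (by positivity) (fun v hv v' hv' ↦ by
      have hv := hball hv
      have hv' := hball hv'
      have hest := (hsol v hv).norm_pos_sub_sub_le (hsol v' hv') hlip (by norm_num)
        (by norm_num) ((hu0 v hv).trans (hu0 v' hv').symm)
      rw [hw0 v hv, hw0 v' hv'] at hest
      linarith) hclose
  exact ⟨u v, w v, hsol v (hball hv), hu0 v (hball hv), hvx⟩

end Spray

section APriori

theorem monotoneOn_mul_exp {D : Set ℝ} (hD : Convex ℝ D) {f p p' : ℝ → ℝ} {k : ℝ}
    (hf : ∀ s ∈ D, HasDerivWithinAt f (p s) D s) (hp : ∀ s ∈ D, HasDerivWithinAt p (p' s) D s)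
    (hp' : ∀ s ∈ D, -(k * p s ^ 2) ≤ p' s) : MonotoneOn (fun s ↦ p s * Real.exp (k * f s)) D := by
  have hd : ∀ s ∈ D, HasDerivWithinAt (fun s ↦ p s * Real.exp (k * f s))
      (p' s * Real.exp (k * f s) + p s * (Real.exp (k * f s) * (k * p s))) D s :=
    fun s hs ↦ (hp s hs).mul ((hf s hs).const_mul k).exp
  refine monotoneOn_of_hasDerivWithinAt_nonneg hD (fun s hs ↦ (hd s hs).continuousWithinAt)
    (fun s hs ↦ (hd s (interior_subset hs)).mono interior_subset) fun s hs ↦ ?_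
  calc 0 ≤ (p' s + k * p s ^ 2) * Real.exp (k * f s) :=
        mul_nonneg (by linarith [hp' s (interior_subset hs)]) (Real.exp_pos _).le
    _ = _ := by ring

theorem le_mul_exp_of_abs_deriv_le {D : Set ℝ} (hD : Convex ℝ D) {f p p' : ℝ → ℝ} {k : ℝ}
    (hk : 0 ≤ k) (hf : ∀ s ∈ D, HasDerivWithinAt f (p s) D s)
    (hp : ∀ s ∈ D, HasDerivWithinAt p (p' s) D s) (hp' : ∀ s ∈ D, |p' s| ≤ k * p s ^ 2)
    (hp0 : ∀ s ∈ D, 0 ≤ p s) {s m : ℝ} (hs : s ∈ D) (hm : m ∈ D) :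
    p s ≤ p m * Real.exp (k * |f s - f m|) := by
  have of_le : ∀ a b : ℝ, a - b ≤ k * |f s - f m| →
      p s * Real.exp b ≤ p m * Real.exp a → p s ≤ p m * Real.exp (k * |f s - f m|) :=
    fun a b hab hle ↦ calc
      p s ≤ p m * Real.exp (a - b) := by
        rw [Real.exp_sub, mul_div_assoc', le_div_iff₀ (Real.exp_pos _)]
        exact hle
      _ ≤ p m * Real.exp (k * |f s - f m|) := by
        gcongr
        exact hp0 m hm
  rcases le_total s m with hsm | hsm
  · have hmono := monotoneOn_mul_exp hD hf hp fun s hs ↦ (abs_le.1 (hp' s hs)).1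
    refine of_le _ _ ?_ (hmono hs hm hsm)
    rw [← mul_sub, abs_sub_comm]
    exact mul_le_mul_of_nonneg_left (le_abs_self _) hk
  · have hmono := monotoneOn_mul_exp hD (fun s hs ↦ (hf s hs).neg) (fun s hs ↦ (hp s hs).neg)
      (k := k) fun s hs ↦ by
        rw [neg_sq]
        exact neg_le_neg (abs_le.1 (hp' s hs)).2
    refine of_le (k * -f m) (k * -f s) ?_ (by simpa using hmono hm hs hsm)
    rw [← mul_sub, neg_sub_neg]
    exact mul_le_mul_of_nonneg_left (le_abs_self _) hk

variable {E : Type*} [NormedAddCommGroup E] [NormedSpace ℝ E]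

theorem IsSpraySolution.mul_norm_vel_le {A : E → E →L[ℝ] E →L[ℝ] E} {u w : ℝ → E}
    (h : IsSpraySolution A (Icc 0 1) u w) {ℓ : E →L[ℝ] ℝ} {c K Δ : ℝ} (hc : 0 < c) (hK : 0 ≤ K)
    (hA : ∀ s ∈ Icc (0 : ℝ) 1, ‖A (u s)‖ ≤ K)
    (hℓ : ∀ s ∈ Icc (0 : ℝ) 1, c * ‖w s‖ ≤ ℓ (w s))
    (hΔ : ∀ s ∈ Icc (0 : ℝ) 1, ∀ s' ∈ Icc (0 : ℝ) 1, |ℓ (u s) - ℓ (u s')| ≤ Δ)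
    {s : ℝ} (hs : s ∈ Icc (0 : ℝ) 1) :
    c * ‖w s‖ ≤ Δ * Real.exp (‖ℓ‖ * K / c ^ 2 * Δ) := by
  have hpos : ∀ s ∈ Icc (0 : ℝ) 1, HasDerivWithinAt (fun s ↦ ℓ (u s)) (ℓ (w s)) (Icc 0 1) s :=
    fun s hs ↦ ℓ.hasFDerivAt.comp_hasDerivWithinAt s (h.pos s hs)
  have hvel : ∀ s ∈ Icc (0 : ℝ) 1,
      HasDerivWithinAt (fun s ↦ ℓ (w s)) (ℓ (A (u s) (w s) (w s))) (Icc 0 1) s :=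
    fun s hs ↦ ℓ.hasFDerivAt.comp_hasDerivWithinAt s (h.vel s hs)
  have hnonneg : ∀ s ∈ Icc (0 : ℝ) 1, 0 ≤ ℓ (w s) := fun s hs ↦
    (by positivity : 0 ≤ c * ‖w s‖).trans (hℓ s hs)
  have hacc : ∀ s ∈ Icc (0 : ℝ) 1,
      |ℓ (A (u s) (w s) (w s))| ≤ ‖ℓ‖ * K / c ^ 2 * ℓ (w s) ^ 2 := fun s hs ↦ by
    have hw : ‖w s‖ ≤ ℓ (w s) / c := (le_div_iff₀' hc).2 (hℓ s hs)
    calc |ℓ (A (u s) (w s) (w s))| ≤ ‖ℓ‖ * ‖A (u s) (w s) (w s)‖ := ℓ.le_opNorm _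
      _ ≤ ‖ℓ‖ * (‖A (u s)‖ * ‖w s‖ * ‖w s‖) := by gcongr; exact (A (u s)).le_opNorm₂ _ _
      _ ≤ ‖ℓ‖ * (K * (ℓ (w s) / c) * (ℓ (w s) / c)) := by
        gcongr
        · exact mul_nonneg hK (div_nonneg (hnonneg s hs) hc.le)
        · exact hA s hs
      _ = ‖ℓ‖ * K / c ^ 2 * ℓ (w s) ^ 2 := by field_simp
  obtain ⟨m, hm, hslope⟩ := exists_hasDerivAt_eq_slope (fun s ↦ ℓ (u s)) (fun s ↦ ℓ (w s))
    zero_lt_one (fun s hs ↦ (hpos s hs).continuousWithinAt)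
    (fun s hs ↦ (hpos s (Ioo_subset_Icc_self hs)).hasDerivAt (Icc_mem_nhds hs.1 hs.2))
  have hmI : m ∈ Icc (0 : ℝ) 1 := Ioo_subset_Icc_self hm
  have hmΔ : ℓ (w m) ≤ Δ := by
    simpa [hslope] using (le_abs_self _).trans (hΔ 1 (by simp) 0 (by simp))
  calc c * ‖w s‖ ≤ ℓ (w s) := hℓ s hs
    _ ≤ ℓ (w m) * Real.exp (‖ℓ‖ * K / c ^ 2 * |ℓ (u s) - ℓ (u m)|) :=
      le_mul_exp_of_abs_deriv_le (convex_Icc 0 1) (by positivity) hpos hvel hacc hnonneg hs hmI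
    _ ≤ Δ * Real.exp (‖ℓ‖ * K / c ^ 2 * Δ) := by
      gcongr
      · exact (hnonneg m hmI).trans hmΔ
      · exact hΔ s hs m hmI

end APriori

section LorentzForm

variable {E : Type*} [NormedAddCommGroup E] [NormedSpace ℝ E]

/-- A Lorentz form: a symmetric bilinear form that is positive definite on the orthogonal complement
of every timelike vector. Signature `(-,+,…,+)` implies this (`IsLorentzForm.of_basis`), and it is
the only consequence of the signature that is needed. -/
structure IsLorentzForm (B : E →L[ℝ] E →L[ℝ] ℝ) : Prop where
  symm : ∀ v w, B v w = B w v
  pos : ∀ T v, B T T < 0 → B T v = 0 → v ≠ 0 → 0 < B v v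

/-- The time cone of a timelike vector `T`: the timelike vectors that point in the same time
direction as `T`. -/
def timecone (B : E →L[ℝ] E →L[ℝ] ℝ) (T : E) : Set E :=
  {v | B v v < 0 ∧ B T v < 0}

namespace IsLorentzForm

variable {B : E →L[ℝ] E →L[ℝ] ℝ} {T X v w : E}

theorem of_basis {n : ℕ} (b : Module.Basis (Fin (n + 1)) ℝ E)
    (hb : ∀ i j, B (b i) (b j) = if i = j then (if i = 0 then -1 else 1) else 0) :
    IsLorentzForm B := by
  have hB : ∀ v w, B v w = -(b.repr w 0 * b.repr v 0)
      + ∑ i : Fin n, b.repr w i.succ * b.repr v i.succ := fun v w ↦ by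
    calc B v w = ∑ j, b.repr w j * ∑ i, b.repr v i * B (b i) (b j) := by
          conv_lhs => rw [← b.sum_repr v, ← b.sum_repr w]
          simp [-Module.Basis.sum_repr]
      _ = _ := by
          simp [hb, Fin.sum_univ_succ, Fin.succ_ne_zero]
  refine ⟨fun v w ↦ by simp only [hB, mul_comm], fun T v hT hTv hv ↦ ?_⟩
  rw [hB] at hT hTv ⊢
  simp only [← sq] at hT ⊢
  have hcs := Finset.sum_mul_sq_le_sq_mul_sq Finset.univ (fun i : Fin n ↦ b.repr v i.succ)
    (fun i ↦ b.repr T i.succ)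
  have hT0 : 0 < b.repr T 0 ^ 2 := by
    linarith [Finset.sum_nonneg fun (i : Fin n) (_ : i ∈ Finset.univ) ↦ sq_nonneg (b.repr T i.succ)]
  have hspace : 0 < ∑ i : Fin n, b.repr v i.succ ^ 2 := by
    refine (Finset.sum_nonneg fun i _ ↦ sq_nonneg _).lt_of_ne' fun h0 ↦ hv ?_
    have hsucc : ∀ i : Fin n, b.repr v i.succ = 0 := by
      simpa [Finset.sum_eq_zero_iff_of_nonneg, sq_nonneg] using h0
    have hzero : b.repr v 0 = 0 := by
      simpa [hsucc, (sq_pos_iff.1 hT0)] using hTv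
    exact b.repr.map_eq_zero_iff.1 (Finsupp.ext (Fin.cases hzero hsucc))
  rw [← neg_add_eq_zero.1 hTv, mul_pow] at hcs
  have hlt : b.repr v 0 ^ 2 * b.repr T 0 ^ 2 <
      (∑ i : Fin n, b.repr v i.succ ^ 2) * b.repr T 0 ^ 2 :=
    hcs.trans_lt (by gcongr; linarith)
  linarith [lt_of_mul_lt_mul_right hlt hT0.le]

theorem eq_zero_of_causal (hB : IsLorentzForm B) (hT : B T T < 0) (hv : B v v ≤ 0)
    (h : B T v = 0) : v = 0 := by
  by_contra hne
  exact (hB.pos T v hT h hne).not_ge hv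

theorem apply_neg (hB : IsLorentzForm B) (hT : B T T < 0) (hv : B v v ≤ 0) (hTv : B T v < 0)
    (hw : w ∈ timecone B T) : B v w < 0 := by
  -- `v - μ w` is orthogonal to `T`, hence not timelike
  obtain ⟨μ, hμ, hTμ⟩ : ∃ μ > 0, B T v = μ * B T w :=
    ⟨B T v / B T w, div_pos_of_neg_of_neg hTv hw.2, (div_mul_cancel₀ _ hw.2.ne).symm⟩
  have horth : B T (v - μ • w) = 0 := by simp [hTμ]
  have hspace : 0 ≤ B (v - μ • w) (v - μ • w) :=
    le_of_not_gt fun h ↦ by simp [hB.eq_zero_of_causal hT h.le horth] at h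
  have hexpand : B (v - μ • w) (v - μ • w) = B v v - 2 * μ * B v w + μ ^ 2 * B w w := by
    simp only [map_sub, map_smul, sub_apply, smul_apply, smul_eq_mul, hB.symm w v]
    ring
  have hneg : μ ^ 2 * B w w < 0 := mul_neg_of_pos_of_neg (by positivity) hw.1
  exact neg_of_mul_neg_right (by linarith : 2 * μ * B v w < 0) (by positivity)

theorem add_timelike (hB : IsLorentzForm B) (hT : B T T < 0) (hv : B v v ≤ 0) (hTv : B T v < 0)
    (hw : w ∈ timecone B T) : B (v + w) (v + w) < 0 := by
  have hexpand : B (v + w) (v + w) = B v v + 2 * B v w + B w w := by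
    simp only [map_add, add_apply, hB.symm w v]
    ring
  linarith [hB.apply_neg hT hv hTv hw, hw.1]

theorem injective (hB : IsLorentzForm B) (hT : B T T < 0) : Function.Injective B :=
  (injective_iff_map_eq_zero B).2 fun v hv ↦
    hB.eq_zero_of_causal hT (by simp [hv]) (by simp [hB.symm T, hv])

theorem forall_timecone_neg_iff (hB : IsLorentzForm B) {X₀ : E} (hX₀ : B X₀ X₀ < 0)
    (hX : X ∈ timecone B X₀) (hT : B T T < 0) (hXT : B X T < 0) (hv : B v v ≤ 0) :
    (∀ u ∈ timecone B X₀, B u v < 0) ↔ B T v < 0 := by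
  have hT₀ : B X₀ T < 0 := hB.apply_neg hX.1 hX₀.le (by rw [hB.symm]; exact hX.2) ⟨hT, hXT⟩
  refine ⟨fun h ↦ h T ⟨hT, hT₀⟩, fun h u hu ↦ ?_⟩
  rw [hB.symm]
  exact hB.apply_neg hT hv h ⟨hu.1, hB.apply_neg hX₀ hT.le hT₀ hu⟩

theorem bilinearComp {F : Type*} [NormedAddCommGroup F] [NormedSpace ℝ F] {L : F →L[ℝ] E}
    (hB : IsLorentzForm B) (hL : Function.Injective L) : IsLorentzForm (B.bilinearComp L L) where
  symm _ _ := hB.symm _ _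
  pos _ _ hT hTv hv := hB.pos _ _ hT hTv ((map_ne_zero_iff L hL).2 hv)

theorem exists_mem_Icc_null (hB : IsLorentzForm B) (hT : B T T < 0) {v : ℝ → E} {a b : ℝ}
    (hab : a ≤ b) (hv : ContinuousOn v (Icc a b)) (ha : 0 < B T (v a)) (hb : v b ∈ timecone B T) :
    ∃ t ∈ Icc a b, B (v t) (v t) = 0 ∧ (v t ≠ 0 → B T (v t) < 0) := by
  have hcont : ContinuousOn (fun t ↦ max (B (v t) (v t)) (B T (v t))) (Icc a b) :=
    ((B.continuous.comp_continuousOn hv).clm_apply hv).sup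
      ((B T).continuous.comp_continuousOn hv)
  obtain ⟨t, ht, h0⟩ := intermediate_value_Icc' hab hcont
    ⟨(max_lt hb.1 hb.2).le, (lt_max_of_lt_right ha).le⟩
  have hvv : B (v t) (v t) ≤ 0 := (le_max_left _ _).trans_eq h0
  have hTv : B T (v t) ≤ 0 := (le_max_right _ _).trans_eq h0
  have hzero : B T (v t) = 0 → v t = 0 := hB.eq_zero_of_causal hT hvv
  refine ⟨t, ht, ?_, fun hne ↦ hTv.lt_of_ne fun h ↦ hne (hzero h)⟩
  rcases max_eq_iff.1 h0 with h | h
  · exact h.1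
  · simp [hzero h.1]

end IsLorentzForm

variable {G : E → E →L[ℝ] E →L[ℝ] ℝ} {x₀ T : E}

theorem eventually_forall_mul_norm_le_of_causal [FiniteDimensional ℝ E] (hG : ContinuousAt G x₀)
    (hB : IsLorentzForm (G x₀)) (hT : G x₀ T T < 0) :
    ∃ c > 0, ∀ᶠ y in 𝓝 x₀, ∀ v, G y v v ≤ 0 → G y T v ≤ 0 → c * ‖v‖ ≤ -(G x₀ T v) := by
  let f : E × E → ℝ := fun z ↦ max (G z.1 z.2 z.2) (max (G z.1 T z.2) (-(G x₀ T z.2)))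
  have hf : ∀ v, ContinuousAt f (x₀, v) := fun v ↦ by
    have hG' : ContinuousAt (fun z : E × E ↦ G z.1) (x₀, v) :=
      ContinuousAt.comp (g := G) hG continuousAt_fst
    exact ((hG'.clm_apply continuousAt_snd).clm_apply continuousAt_snd).max
      (((hG'.clm_apply continuousAt_const).clm_apply continuousAt_snd).max
        ((G x₀ T).continuous.continuousAt.comp continuousAt_snd).neg)
  have hpos : ∀ v ∈ sphere (0 : E) 1, 0 < f (x₀, v) := fun v hv ↦ by
    by_contra! hle
    simp only [f, max_le_iff, neg_nonpos] at hle
    exact ne_zero_of_mem_unit_sphere ⟨v, hv⟩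
      (hB.eq_zero_of_causal hT hle.1 (hle.2.1.antisymm hle.2.2))
  obtain ⟨c, hc, hmin⟩ := (isCompact_sphere (0 : E) 1).exists_forall_le'
    (fun v _ ↦ ((hf v).comp (by fun_prop : ContinuousAt (fun v ↦ (x₀, v)) v)).continuousWithinAt)
    hpos
  refine ⟨c / 2, half_pos hc, ?_⟩
  filter_upwards [(isCompact_sphere (0 : E) 1).eventually_forall_of_forall_eventually
    (P := fun y v ↦ c / 2 < f (y, v)) fun v hv ↦
      (hf v).eventually (lt_mem_nhds ((half_lt_self hc).trans_le (hmin v hv)))]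
    with y hy v hvv hTv
  rcases eq_or_ne v 0 with rfl | hv
  · simp
  have hn : 0 < ‖v‖ := norm_pos_iff.2 hv
  have hunit := hy (‖v‖⁻¹ • v) (by simp [norm_smul, hn.ne'])
  have hinv : 0 ≤ ‖v‖⁻¹ := by positivity
  simp only [f, map_smul, smul_apply, smul_eq_mul, lt_max_iff] at hunit
  rcases hunit with h | h | h
  · nlinarith [mul_nonneg hinv hinv]
  · nlinarith
  · rw [← mul_neg, lt_inv_mul_iff₀ hn, mul_comm] at h
    exact h.le

theorem exists_eventually_ball_subset_timecone (hG : ContinuousAt G x₀) (hT : G x₀ T T < 0) :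
    ∃ ε > 0, ∀ᶠ y in 𝓝 x₀, ball T ε ⊆ timecone (G y) T := by
  have hG' : ContinuousAt (fun z : E × E ↦ G z.1) (x₀, T) :=
    ContinuousAt.comp (g := G) hG continuousAt_fst
  have hcone : ∀ᶠ z in 𝓝 x₀ ×ˢ 𝓝 T, z.2 ∈ timecone (G z.1) T := by
    rw [← nhds_prod_eq]
    exact (((hG'.clm_apply continuousAt_snd).clm_apply continuousAt_snd).eventually_lt_const
      hT).and (((hG'.clm_apply continuousAt_const).clm_apply continuousAt_snd).eventually_lt_const
        hT)
  obtain ⟨P, hP, Q, hQ, h⟩ := Filter.eventually_prod_iff.1 hcone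
  obtain ⟨ε, hε, hQ⟩ := Metric.eventually_nhds_iff.1 hQ
  exact ⟨ε, hε, hP.mono fun y hy e he ↦ h hy (hQ he)⟩

end LorentzForm

section GeodesicSpray

variable {E : Type*} [NormedAddCommGroup E] [NormedSpace ℝ E] {G : E → E →L[ℝ] E →L[ℝ] ℝ}

/-- The Christoffel symbols of the first kind of a metric `G` on (an open subset of) a vector
space, contracted with constant vectors as in `LorentzMetric.christoffel`. -/
noncomputable def metricChristoffel (G : E → E →L[ℝ] E →L[ℝ] ℝ) (y a b w : E) : ℝ :=
  (fderiv ℝ G y a b w + fderiv ℝ G y b a w - fderiv ℝ G y w a b) / 2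

/-- The Christoffel symbols of the first kind as a bilinear map into the dual space. -/
noncomputable def metricChristoffelMap (G : E → E →L[ℝ] E →L[ℝ] ℝ) (y : E) :
    E →L[ℝ] E →L[ℝ] E →L[ℝ] ℝ :=
  (1 / 2 : ℝ) • (fderiv ℝ G y + (fderiv ℝ G y).flip
    - (ContinuousLinearMap.flipₗᵢ ℝ E E ℝ : (E →L[ℝ] E →L[ℝ] ℝ) →L[ℝ] E →L[ℝ] E →L[ℝ] ℝ) ∘L
      (fderiv ℝ G y).flip)

theorem metricChristoffelMap_apply (G : E → E →L[ℝ] E →L[ℝ] ℝ) (y a b w : E) :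
    metricChristoffelMap G y a b w = metricChristoffel G y a b w := by
  simp only [metricChristoffelMap, one_div, smul_apply, sub_apply, add_apply,
    ContinuousLinearMap.comp_apply, ContinuousLinearEquiv.coe_coe,
    LinearIsometryEquiv.coe_toContinuousLinearEquiv, ContinuousLinearMap.coe_flipₗᵢ,
    ContinuousLinearMap.flip_apply, smul_eq_mul, metricChristoffel]
  ring

/-- The geodesic spray of a metric: geodesics solve `u'' = A(u)(u', u')`, where `A` is the negative
of the Christoffel symbols with their last index raised. It is meaningful where `G` is
nondegenerate, since `inverse` is `0` at a map that is not invertible. -/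
noncomputable def geodesicSpray (G : E → E →L[ℝ] E →L[ℝ] ℝ) (y : E) : E →L[ℝ] E →L[ℝ] E :=
  -(ContinuousLinearMap.compL ℝ E (E →L[ℝ] ℝ) E (G y).inverse ∘L metricChristoffelMap G y)

theorem isInvertible_of_injective [FiniteDimensional ℝ E] {B : E →L[ℝ] E →L[ℝ] ℝ}
    (hB : Function.Injective B) : B.IsInvertible := by
  have hdim : Module.finrank ℝ E = Module.finrank ℝ (E →L[ℝ] ℝ) := by
    rw [← (LinearMap.toContinuousLinearMap (𝕜 := ℝ) (E := E) (F' := ℝ)).finrank_eq]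
    exact (Subspace.dual_finrank_eq (K := ℝ) (V := E)).symm
  have := FiniteDimensional.complete ℝ E
  let e := LinearEquiv.ofInjectiveOfFinrankEq (B : E →ₗ[ℝ] E →L[ℝ] ℝ) hB hdim
  exact ⟨e.toContinuousLinearEquiv, by ext; rfl⟩

theorem geodesicSpray_eq_iff {y : E} (hG : (G y).IsInvertible) (a b : E) :
    (∀ w, G y b w + metricChristoffel G y a a w = 0) ↔ b = geodesicSpray G y a a := by
  obtain ⟨e, he⟩ := hG
  have hspray : geodesicSpray G y a a = -e.symm (metricChristoffelMap G y a a) := by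
    change -(G y).inverse (metricChristoffelMap G y a a) = _
    rw [← he, ContinuousLinearMap.inverse_equiv, ContinuousLinearEquiv.coe_coe]
  rw [hspray, ← map_neg, ContinuousLinearEquiv.eq_symm_apply, ContinuousLinearMap.ext_iff]
  refine forall_congr' fun w ↦ ?_
  rw [← he, neg_apply, metricChristoffelMap_apply, ← add_eq_zero_iff_eq_neg]
  rfl

theorem contDiffAt_geodesicSpray [CompleteSpace E] {x₀ : E} (hG : ContDiffAt ℝ 2 G x₀)
    (hinv : (G x₀).IsInvertible) : ContDiffAt ℝ 1 (geodesicSpray G) x₀ := by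
  have hD : ContDiffAt ℝ 1 (fderiv ℝ G) x₀ := hG.fderiv_right (by norm_num)
  have hflip : ContDiffAt ℝ 1 (fun y ↦ (fderiv ℝ G y).flip) x₀ :=
    (ContinuousLinearMap.flipₗᵢ ℝ E E (E →L[ℝ] ℝ)).contDiff.contDiffAt.comp x₀ hD
  have hΓ : ContDiffAt ℝ 1 (metricChristoffelMap G) x₀ :=
    ((hD.add hflip).sub (contDiffAt_const.clm_comp hflip)).const_smul (1 / 2 : ℝ)
  have hinverse : ContDiffAt ℝ 1 (fun y ↦ (G y).inverse) x₀ := by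
    obtain ⟨e, he⟩ := hinv
    exact ContDiffAt.comp x₀ (he ▸ contDiffAt_map_inverse e) (hG.of_le one_le_two)
  exact (((ContinuousLinearMap.compL ℝ E (E →L[ℝ] ℝ) E).contDiff.contDiffAt.comp x₀
    hinverse).clm_comp hΓ).neg

theorem hasDerivWithinAt_apply_vel_vel {u w : ℝ → E} {a : E} {J : Set ℝ} {s : ℝ}
    (hG : DifferentiableAt ℝ G (u s)) (hsymm : ∀ v w, G (u s) v w = G (u s) w v)
    (hu : HasDerivWithinAt u (w s) J s) (hw : HasDerivWithinAt w a J s)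
    (hgeo : ∀ x, G (u s) a x + metricChristoffel G (u s) (w s) (w s) x = 0) :
    HasDerivWithinAt (fun r ↦ G (u r) (w r) (w r)) 0 J s := by
  have hGu : HasDerivWithinAt (fun r ↦ G (u r)) (fderiv ℝ G (u s) (w s)) J s :=
    hG.hasFDerivAt.comp_hasDerivWithinAt s hu
  refine ((hGu.clm_apply hw).clm_apply hw).congr_deriv ?_
  have hgeo_w := hgeo (w s)
  simp only [metricChristoffel] at hgeo_w
  simp only [add_apply, hsymm (w s) a]
  linarith

end GeodesicSpray

section RadarBall

variable {E : Type*} [NormedAddCommGroup E] [NormedSpace ℝ E]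
  {G : E → E →L[ℝ] E →L[ℝ] ℝ} {T x₀ q : E} {c ρ : ℝ} {u w u₁ w₁ u₂ w₂ : ℝ → E}

theorem smul_mem_timecone {B : E →L[ℝ] E →L[ℝ] ℝ} {v : E} {t : ℝ} (ht : 0 < t)
    (hv : v ∈ timecone B T) : t • v ∈ timecone B T := by
  simp only [timecone, mem_ofPred_eq, map_smul, smul_apply, smul_eq_mul]
  exact ⟨mul_neg_of_pos_of_neg ht (mul_neg_of_pos_of_neg ht hv.1), mul_neg_of_pos_of_neg ht hv.2⟩

theorem exists_forall_mem_ball_of_norm_sub_le_mul_norm {F : Type*} [NormedAddCommGroup F] (T : F)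
    {ε : ℝ} (hε : 0 < ε) : ∃ κ ∈ Ioc (0 : ℝ) (1 / 4), ∃ c > 0, ∀ b e : F,
      ‖b - T‖ ≤ c → ‖b - e‖ ≤ 2 * κ * ‖e‖ → e ∈ ball T ε := by
  have hden : 0 < 8 * (‖T‖ + ε / 4) := by positivity
  refine ⟨min (1 / 4) (ε / (8 * (‖T‖ + ε / 4))), ⟨by positivity, min_le_left _ _⟩, ε / 4,
    by positivity, fun b e hb he ↦ ?_⟩
  set κ := min (1 / 4) (ε / (8 * (‖T‖ + ε / 4)))
  have hκ : κ * (8 * (‖T‖ + ε / 4)) ≤ ε := (le_div_iff₀ hden).1 (min_le_right _ _)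
  have hhalf : 2 * κ * ‖e‖ ≤ 1 / 2 * ‖e‖ := by
    gcongr
    linarith [min_le_left (1 / 4) (ε / (8 * (‖T‖ + ε / 4)))]
  have hnorm : ‖e‖ ≤ 2 * (‖T‖ + ε / 4) := by
    linarith [norm_sub_norm_le e b, norm_sub_rev e b, norm_sub_norm_le b T]
  rw [mem_ball_iff_norm]
  calc ‖e - T‖ ≤ ‖b - e‖ + ‖b - T‖ := norm_sub_rev b e ▸ norm_sub_le_norm_sub_add_norm_sub e b T
    _ ≤ 2 * κ * (2 * (‖T‖ + ε / 4)) + ε / 4 := by gcongr; exact he.trans (by gcongr)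
    _ < ε := by linarith

/-- A ball around `x₀` in which radar ranging with clocks of velocity close to `T` works: two short
geodesics that start at the same point, and whose endpoints differ by a chord with direction close
to `T`, have initial velocities whose difference is timelike and points to the same side as `T`.
The tolerance for the chord, relative to its length, is `c`. -/
structure IsRadarBall (G : E → E →L[ℝ] E →L[ℝ] ℝ) (T x₀ : E) (c ρ : ℝ) : Prop where
  differentiableAt : ∀ y ∈ ball x₀ ρ, DifferentiableAt ℝ G y
  isLorentzForm : ∀ y ∈ ball x₀ ρ, IsLorentzForm (G y)
  timelike : ∀ y ∈ ball x₀ ρ, G y T T < 0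
  lipschitz : IsSprayLipschitz (geodesicSpray G) x₀ ρ (1 / 4)
  vel_sub_mem_timecone : ∀ u₁ w₁ u₂ w₂ : ℝ → E, IsSpraySolutionIn (geodesicSpray G) x₀ ρ u₁ w₁ →
    IsSpraySolutionIn (geodesicSpray G) x₀ ρ u₂ w₂ → u₁ 0 = u₂ 0 → ∀ t > 0,
    ‖u₂ 1 - u₁ 1 - t • T‖ ≤ c * t → w₂ 0 - w₁ 0 ∈ timecone (G (u₁ 0)) T

theorem exists_isRadarBall [FiniteDimensional ℝ E] (hG : ContDiffAt ℝ 2 G x₀)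
    (hL : ∀ᶠ y in 𝓝 x₀, IsLorentzForm (G y)) (hT : G x₀ T T < 0) :
    ∃ c > 0, ∃ ρ > 0, IsRadarBall G T x₀ c ρ := by
  have := FiniteDimensional.complete ℝ E
  obtain ⟨ε, hε, hcone⟩ := exists_eventually_ball_subset_timecone hG.continuousAt hT
  obtain ⟨κ, ⟨hκ₀, hκ⟩, c, hc, hnear⟩ := exists_forall_mem_ball_of_norm_sub_le_mul_norm T hε
  have hdiff : ∀ᶠ y in 𝓝 x₀, DifferentiableAt ℝ G y :=
    (hG.eventually (by simp)).mono fun y hy ↦ hy.differentiableAt two_ne_zero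
  obtain ⟨ρ₁, hρ₁, hlip⟩ := exists_isSprayLipschitz
    (contDiffAt_geodesicSpray hG (isInvertible_of_injective (hL.self_of_nhds.injective hT))) hκ₀
  obtain ⟨ρ₂, hρ₂, hball⟩ := Metric.eventually_nhds_iff_ball.1 (hcone.and (hL.and hdiff))
  have hsub : ball x₀ (min ρ₁ ρ₂) ⊆ ball x₀ ρ₂ := ball_subset_ball (min_le_right _ _)
  refine ⟨c, hc, min ρ₁ ρ₂, by positivity, fun y hy ↦ (hball y (hsub hy)).2.2,
    fun y hy ↦ (hball y (hsub hy)).2.1, fun y hy ↦ ((hball y (hsub hy)).1 (mem_ball_self hε)).1,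
    hlip.mono (min_le_left _ _) hκ, fun u₁ w₁ u₂ w₂ h₁ h₂ h0 t ht hchord ↦ ?_⟩
  have hend := h₂.norm_pos_sub_sub_le h₁ (hlip.mono (min_le_left _ _) le_rfl) hκ₀.le
    (hκ.trans (by norm_num)) h0.symm
  have hmem : t⁻¹ • (w₂ 0 - w₁ 0) ∈ ball T ε := by
    refine hnear (t⁻¹ • (u₂ 1 - u₁ 1)) _ ?_ ?_
    · rwa [← inv_smul_smul₀ ht.ne' T, ← smul_sub, norm_smul, norm_inv, Real.norm_of_nonneg ht.le,
        inv_mul_le_iff₀ ht, mul_comm]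
    · rw [← smul_sub, norm_smul, norm_smul, mul_left_comm]
      gcongr
  rw [← smul_inv_smul₀ ht.ne' (w₂ 0 - w₁ 0)]
  exact smul_mem_timecone ht
    ((hball _ (hsub (h₁.pos_mem 0 (left_mem_Icc.2 zero_le_one)))).1 hmem)

namespace IsRadarBall

theorem mono (h : IsRadarBall G T x₀ c ρ) {ρ' : ℝ} (hρ : ρ' ≤ ρ) : IsRadarBall G T x₀ c ρ' where
  differentiableAt y hy := h.differentiableAt y (ball_subset_ball hρ hy)
  isLorentzForm y hy := h.isLorentzForm y (ball_subset_ball hρ hy)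
  timelike y hy := h.timelike y (ball_subset_ball hρ hy)
  lipschitz := h.lipschitz.mono hρ le_rfl
  vel_sub_mem_timecone _ _ _ _ h₁ h₂ := h.vel_sub_mem_timecone _ _ _ _ (h₁.mono hρ) (h₂.mono hρ)

theorem isInvertible [FiniteDimensional ℝ E] (h : IsRadarBall G T x₀ c ρ) {y : E}
    (hy : y ∈ ball x₀ ρ) : (G y).IsInvertible :=
  isInvertible_of_injective ((h.isLorentzForm y hy).injective (h.timelike y hy))

theorem vel_mem_timecone (h : IsRadarBall G T x₀ c ρ)
    (hu : IsSpraySolutionIn (geodesicSpray G) x₀ ρ u w) {t : ℝ} (ht : 0 < t)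
    (hchord : ‖u 1 - u 0 - t • T‖ ≤ c * t) : w 0 ∈ timecone (G (u 0)) T := by
  simpa using h.vel_sub_mem_timecone _ _ _ _ hu.const_pos_zero hu rfl t ht hchord

theorem neg_vel_mem_timecone (h : IsRadarBall G T x₀ c ρ)
    (hu : IsSpraySolutionIn (geodesicSpray G) x₀ ρ u w) {t : ℝ} (ht : 0 < t)
    (hchord : ‖u 0 - u 1 - t • T‖ ≤ c * t) : -w 0 ∈ timecone (G (u 0)) T := by
  simpa using h.vel_sub_mem_timecone _ _ _ _ hu hu.const_pos_zero rfl t ht hchord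

end IsRadarBall

end RadarBall

section NullRay

variable {E : Type*} [NormedAddCommGroup E] [NormedSpace ℝ E]
  {G : E → E →L[ℝ] E →L[ℝ] ℝ} {T x₀ q : E} {c ρ : ℝ} {V S : Set E} {u w u₁ w₁ u₂ w₂ : ℝ → E}

/-- A light ray of the metric `G` on a vector space: a lightlike geodesic `u : [0,1] → V` with
velocity `w`, which points to the same side as `T`, from `q` to a point of `S`. -/
structure IsNullRay (G : E → E →L[ℝ] E →L[ℝ] ℝ) (T : E) (V S : Set E) (q : E) (u w : ℝ → E) :
    Prop extends IsSpraySolution (geodesicSpray G) (Icc 0 1) u w where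
  null : ∀ s ∈ Icc (0 : ℝ) 1, G (u s) (w s) (w s) = 0
  future : ∀ s ∈ Icc (0 : ℝ) 1, G (u s) T (w s) < 0
  start : u 0 = q
  finish : u 1 ∈ S
  stays : ∀ s ∈ Icc (0 : ℝ) 1, u s ∈ V

theorem IsRadarBall.apply_vel_vel_eq [FiniteDimensional ℝ E] (h : IsRadarBall G T x₀ c ρ)
    (hu : IsSpraySolutionIn (geodesicSpray G) x₀ ρ u w) {s : ℝ} (hs : s ∈ Icc (0 : ℝ) 1) :
    G (u s) (w s) (w s) = G (u 0) (w 0) (w 0) := by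
  have hspeed : ∀ s ∈ Icc (0 : ℝ) 1,
      HasDerivWithinAt (fun s ↦ G (u s) (w s) (w s)) 0 (Icc 0 1) s := fun s hs ↦
    have hus := hu.pos_mem s hs
    hasDerivWithinAt_apply_vel_vel (h.differentiableAt _ hus) (h.isLorentzForm _ hus).symm
      (hu.pos s hs) (hu.vel s hs) ((geodesicSpray_eq_iff (h.isInvertible hus) _ _).2 rfl)
  simpa [sub_eq_zero] using
    norm_sub_zero_le_of_norm_hasDerivWithin_le (C := 0) hspeed (by simp) hs

theorem IsRadarBall.isNullRay [FiniteDimensional ℝ E] (h : IsRadarBall G T x₀ c ρ)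
    (hu : IsSpraySolutionIn (geodesicSpray G) x₀ ρ u w) (hnull : G (u 0) (w 0) (w 0) = 0)
    (hfut : G (u 0) T (w 0) < 0) (hS : u 1 ∈ S) : IsNullRay G T (ball x₀ ρ) S (u 0) u w := by
  have hnull' : ∀ s ∈ Icc (0 : ℝ) 1, G (u s) (w s) (w s) = 0 := fun s hs ↦
    (h.apply_vel_vel_eq hu hs).trans hnull
  have hw : ∀ s ∈ Icc (0 : ℝ) 1, w s ≠ 0 := fun s hs ↦
    hu.vel_ne_zero h.lipschitz (fun h0 ↦ hfut.ne (by simp [h0])) hs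
  have hcont : ContinuousOn (fun s ↦ G (u s) T (w s)) (Icc 0 1) := fun s hs ↦
    (((h.differentiableAt _ (hu.pos_mem s hs)).continuousAt.comp_continuousWithinAt
      (hu.pos s hs).continuousWithinAt).clm_apply continuousWithinAt_const).clm_apply
      (hu.vel s hs).continuousWithinAt
  refine ⟨hu.1, hnull', fun s hs ↦ ?_, rfl, hS, hu.pos_mem⟩
  by_contra! hneg
  have hsub : Icc 0 s ⊆ Icc (0 : ℝ) 1 := Icc_subset_Icc_right hs.2
  obtain ⟨m, hm, hm0⟩ := intermediate_value_Icc hs.1 (hcont.mono hsub) ⟨hfut.le, hneg⟩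
  have hum := hu.pos_mem m (hsub hm)
  exact hw m (hsub hm) ((h.isLorentzForm _ hum).eq_zero_of_causal (h.timelike _ hum)
    (hnull' m (hsub hm)).le hm0)

theorem IsRadarBall.lt_norm_chord_of_isNullRay {V₁ V₂ : Set E} (h : IsRadarBall G T x₀ c ρ)
    (h₁ : IsNullRay G T V₁ S q u₁ w₁) (h₂ : IsNullRay G T V₂ S q u₂ w₂)
    (hs₁ : IsSpraySolutionIn (geodesicSpray G) x₀ ρ u₁ w₁)
    (hs₂ : IsSpraySolutionIn (geodesicSpray G) x₀ ρ u₂ w₂) {t : ℝ} (ht : 0 < t) :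
    c * t < ‖u₂ 1 - u₁ 1 - t • T‖ := by
  by_contra! hchord
  have h0 : (0 : ℝ) ∈ Icc 0 1 := left_mem_Icc.2 zero_le_one
  have hq := hs₁.pos_mem 0 h0
  have h12 : u₁ 0 = u₂ 0 := h₁.start.trans h₂.start.symm
  -- future causal plus future timelike is timelike
  have htimelike := (h.isLorentzForm _ hq).add_timelike (h.timelike _ hq) (h₁.null 0 h0).le
    (h₁.future 0 h0) (h.vel_sub_mem_timecone _ _ _ _ hs₁ hs₂ h12 t ht hchord)
  rw [add_sub_cancel, h12, h₂.null 0 h0] at htimelike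
  exact htimelike.false

theorem eventually_isSpraySolutionIn_of_isNullRay [FiniteDimensional ℝ E]
    (hG : ContDiffAt ℝ 2 G x₀) (hL : IsLorentzForm (G x₀)) (hT : G x₀ T T < 0) (hρ : 0 < ρ) :
    ∀ᶠ R in 𝓝[>] (0 : ℝ), ∀ ⦃S q u w⦄, IsNullRay G T (ball x₀ R) S q u w →
      IsSpraySolutionIn (geodesicSpray G) x₀ ρ u w := by
  have := FiniteDimensional.complete ℝ E
  have hA := contDiffAt_geodesicSpray hG (isInvertible_of_injective (hL.injective hT))
  obtain ⟨c, hc, hcausal⟩ := eventually_forall_mul_norm_le_of_causal hG.continuousAt hL hT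
  obtain ⟨R₀, hR₀, hball⟩ := Metric.eventually_nhds_iff_ball.1
    (hcausal.and (hA.continuousAt.norm.eventually_lt_const (lt_add_one _)))
  have hlim : Filter.Tendsto (fun R : ℝ ↦ ‖G x₀ T‖ * (2 * R) *
      Real.exp (‖-G x₀ T‖ * (‖geodesicSpray G x₀‖ + 1) / c ^ 2 * (‖G x₀ T‖ * (2 * R))))
      (𝓝[>] 0) (𝓝 0) := by
    refine (Continuous.tendsto' (by fun_prop) 0 0 ?_).mono_left nhdsWithin_le_nhds
    simp
  filter_upwards [hlim.eventually_lt_const (mul_pos hc hρ), Ioc_mem_nhdsGT hR₀,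
    Ioc_mem_nhdsGT hρ] with R hR hRR₀ hRρ S q u w h
  have hmem : ∀ s ∈ Icc (0 : ℝ) 1, u s ∈ ball x₀ R₀ := fun s hs ↦
    ball_subset_ball hRR₀.2 (h.stays s hs)
  have hosc : ∀ s ∈ Icc (0 : ℝ) 1, ∀ s' ∈ Icc (0 : ℝ) 1,
      |(-G x₀ T) (u s) - (-G x₀ T) (u s')| ≤ ‖G x₀ T‖ * (2 * R) := fun s hs s' hs' ↦ by
    rw [← map_sub, ← norm_neg (G x₀ T)]
    refine (-G x₀ T).le_opNorm_of_le ?_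
    rw [← dist_eq_norm]
    linarith [dist_triangle_right (u s) (u s') x₀, mem_ball.1 (h.stays s hs),
      mem_ball.1 (h.stays s' hs')]
  refine ⟨h.1, fun s hs ↦ ball_subset_ball hRρ.2 (h.stays s hs), fun s hs ↦ ?_⟩
  rw [mem_ball_zero_iff]
  exact lt_of_mul_lt_mul_left ((h.mul_norm_vel_le hc (by positivity)
    (fun s hs ↦ (hball _ (hmem s hs)).2.le)
    (fun s hs ↦ (hball _ (hmem s hs)).1 _ (h.null s hs).le (h.future s hs).le) hosc hs).trans_lt
      hR) hc.le

theorem IsRadarBall.eqOn_of_isNullRay {V₁ V₂ : Set E} (h : IsRadarBall G T x₀ c ρ)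
    (h₁ : IsNullRay G T V₁ S q u₁ w₁) (h₂ : IsNullRay G T V₂ S q u₂ w₂)
    (hs₁ : IsSpraySolutionIn (geodesicSpray G) x₀ ρ u₁ w₁)
    (hs₂ : IsSpraySolutionIn (geodesicSpray G) x₀ ρ u₂ w₂) {β : ℝ → E} {N : Set ℝ}
    (hβ : ∀ t ∈ N, ∀ t' ∈ N, ‖β t' - β t - (t' - t) • T‖ ≤ c * |t' - t|) {t₁ t₂ : ℝ}
    (ht₁ : t₁ ∈ N) (ht₂ : t₂ ∈ N) (hu₁ : β t₁ = u₁ 1) (hu₂ : β t₂ = u₂ 1) :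
    EqOn u₁ u₂ (Icc 0 1) := by
  rcases lt_trichotomy t₁ t₂ with hlt | rfl | hlt
  · have hchord := h.lt_norm_chord_of_isNullRay h₁ h₂ hs₁ hs₂ (sub_pos.2 hlt)
    rw [← hu₁, ← hu₂] at hchord
    exact absurd (hβ t₁ ht₁ t₂ ht₂) (by rwa [abs_of_pos (sub_pos.2 hlt), not_le])
  · exact hs₁.eqOn_of_endpoints_eq hs₂ h.lipschitz (h₁.start.trans h₂.start.symm) (hu₁ ▸ hu₂)
  · have hchord := h.lt_norm_chord_of_isNullRay h₂ h₁ hs₂ hs₁ (sub_pos.2 hlt)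
    rw [← hu₁, ← hu₂] at hchord
    exact absurd (hβ t₂ ht₂ t₁ ht₁) (by rwa [abs_of_pos (sub_pos.2 hlt), not_le])

theorem eventually_eqOn_of_isNullRay [FiniteDimensional ℝ E] {β : ℝ → E} {t₀ : ℝ}
    (hG : ContDiffAt ℝ 2 G x₀) (hL : ∀ᶠ y in 𝓝 x₀, IsLorentzForm (G y)) (hT : G x₀ T T < 0)
    (hβ : HasStrictDerivAt β T t₀) (hS : Filter.map β (𝓝 t₀) = 𝓝[S] x₀) :
    ∀ᶠ R in 𝓝[>] (0 : ℝ), ∀ ⦃q u₁ w₁ u₂ w₂⦄, IsNullRay G T (ball x₀ R) S q u₁ w₁ →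
      IsNullRay G T (ball x₀ R) S q u₂ w₂ → EqOn u₁ u₂ (Icc 0 1) := by
  obtain ⟨c, hc, ρ, hρ, hrad⟩ := exists_isRadarBall hG hL hT
  obtain ⟨η, hη, hchord⟩ := Metric.eventually_nhds_iff_ball.1 (hβ.isLittleO.def hc)
  have hparam : ∀ᶠ x in 𝓝 x₀, x ∈ S → ∃ t ∈ ball t₀ η, β t = x := by
    rw [← eventually_nhdsWithin_iff, ← hS]
    exact Filter.image_mem_map (ball_mem_nhds t₀ hη)
  obtain ⟨R₀, hR₀, hparam⟩ := Metric.eventually_nhds_iff_ball.1 hparam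
  filter_upwards [eventually_isSpraySolutionIn_of_isNullRay hG hL.self_of_nhds hT hρ,
    Ioc_mem_nhdsGT hR₀] with R hspray hR q u₁ w₁ u₂ w₂ h₁ h₂
  have hfinish : ∀ u w, IsNullRay G T (ball x₀ R) S q u w → ∃ t ∈ ball t₀ η, β t = u 1 :=
    fun u w h ↦ hparam _ (ball_subset_ball hR.2 (h.stays 1 (right_mem_Icc.2 zero_le_one))) h.finish
  obtain ⟨t₁, ht₁, hu₁⟩ := hfinish u₁ w₁ h₁
  obtain ⟨t₂, ht₂, hu₂⟩ := hfinish u₂ w₂ h₂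
  refine hrad.eqOn_of_isNullRay h₁ h₂ (hspray h₁) (hspray h₂) (fun t ht t' ht' ↦ ?_) ht₁ ht₂ hu₁
    hu₂
  have hmem : (t', t) ∈ ball (t₀, t₀) η := by
    rw [← ball_prod_same]
    exact ⟨ht', ht⟩
  simpa using hchord _ hmem

theorem IsRadarBall.exists_isNullRay [FiniteDimensional ℝ E] (h : IsRadarBall G T x₀ c ρ)
    {β : ℝ → E} {a b τ : ℝ} (hab : a ≤ b) (hβ : ContinuousOn β (Icc a b))
    (hβS : ∀ t ∈ Icc a b, β t ∈ S) (hqS : q ∉ S)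
    (hjoin : ∀ t ∈ Icc a b, ∃ u w : ℝ → E, IsSpraySolutionIn (geodesicSpray G) x₀ ρ u w ∧
      u 0 = q ∧ u 1 = β t)
    (hτ : 0 < τ) (ha : ‖q - β a - τ • T‖ ≤ c * τ) (hb : ‖β b - q - τ • T‖ ≤ c * τ) :
    ∃ u w, IsNullRay G T (ball x₀ ρ) S q u w := by
  choose! u w hsol hstart hend using hjoin
  have hq : q ∈ ball x₀ ρ := by
    simpa [hstart a (left_mem_Icc.2 hab)] using
      (hsol a (left_mem_Icc.2 hab)).pos_mem 0 (left_mem_Icc.2 zero_le_one)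
  have hlip : ∀ t ∈ Icc a b, ∀ t' ∈ Icc a b, ‖w t 0 - w t' 0‖ ≤ 2 * ‖β t - β t'‖ := by
    intro t ht t' ht'
    simpa only [hend t ht, hend t' ht'] using
      (hsol t ht).norm_vel_sub_le (hsol t' ht') h.lipschitz
        ((hstart t ht).trans (hstart t' ht').symm)
  have hcont : ContinuousOn (fun t ↦ w t 0) (Icc a b) := by
    intro t ht
    refine tendsto_iff_norm_sub_tendsto_zero.2 (squeeze_zero' (.of_forall fun _ ↦ norm_nonneg _)
      (Filter.eventually_of_mem self_mem_nhdsWithin fun t' ht' ↦ hlip t' ht' t ht) ?_)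
    simpa using (tendsto_iff_norm_sub_tendsto_zero.1 (hβ t ht)).const_mul 2
  have hpast : 0 < G q T (w a 0) := by
    have ha' := left_mem_Icc.2 hab
    have := h.neg_vel_mem_timecone (hsol a ha') hτ (by rwa [hstart a ha', hend a ha'])
    simpa [hstart a ha'] using this.2
  have hfuture : w b 0 ∈ timecone (G q) T := by
    have hb' := right_mem_Icc.2 hab
    have := h.vel_mem_timecone (hsol b hb') hτ (by rwa [hstart b hb', hend b hb'])
    rwa [hstart b hb'] at this
  obtain ⟨t, ht, hnull, hfut⟩ := (h.isLorentzForm q hq).exists_mem_Icc_null (h.timelike q hq) hab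
    hcont hpast hfuture
  have hne : w t 0 ≠ 0 := fun h0 ↦ hqS <| by
    rw [← hstart t ht, ← (hsol t ht).apply_one_eq_of_vel_eq_zero h.lipschitz h0, hend t ht]
    exact hβS t ht
  have hray := h.isNullRay (S := S) (hsol t ht) (by rwa [hstart t ht])
    (by rw [hstart t ht]; exact hfut hne) (by rw [hend t ht]; exact hβS t ht)
  exact ⟨u t, w t, hstart t ht ▸ hray⟩

theorem exists_Icc_chord_of_hasStrictDerivAt {β : ℝ → E} {t₀ : ℝ} {N : Set E}
    (hβ : HasStrictDerivAt β T t₀) (hS : Filter.Tendsto β (𝓝 t₀) (𝓝[S] x₀)) (hN : N ∈ 𝓝 x₀)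
    (hc : 0 < c) :
    ∃ τ > 0, ContinuousOn β (Icc (t₀ - τ) (t₀ + τ)) ∧
      (∀ t ∈ Icc (t₀ - τ) (t₀ + τ), β t ∈ S ∩ N) ∧
      ‖x₀ - β (t₀ - τ) - τ • T‖ < c * τ ∧ ‖β (t₀ + τ) - x₀ - τ • T‖ < c * τ := by
  have hβx : β t₀ = x₀ := tendsto_nhds_unique hβ.hasDerivAt.continuousAt
    (hS.mono_right nhdsWithin_le_nhds)
  obtain ⟨K, s, hs, hlip⟩ := hβ.hasStrictFDerivAt.exists_lipschitzOnWith
  obtain ⟨τ, hτ, hnear⟩ := nhds_basis_closedBall.eventually_iff.1 <|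
    (Filter.eventually_mem_set.2 hs).and <|
      (hS.eventually_mem (inter_mem_nhdsWithin S hN)).and <|
        hβ.hasDerivAt.isLittleO.def (half_pos hc)
  rw [Real.closedBall_eq_Icc] at hnear
  have hcτ : c / 2 * τ < c * τ := by gcongr; exact half_lt_self hc
  refine ⟨τ, hτ, hlip.continuousOn.mono fun t ht ↦ (hnear ht).1, fun t ht ↦ (hnear ht).2.1,
    lt_of_le_of_lt ?_ hcτ, lt_of_le_of_lt ?_ hcτ⟩
  · have hchord := (hnear (left_mem_Icc.2 (by linarith))).2.2
    rw [show x₀ - β (t₀ - τ) - τ • T = -(β (t₀ - τ) - x₀ - (-τ) • T) by module, norm_neg]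
    rwa [hβx, sub_sub_cancel_left, norm_neg, Real.norm_of_nonneg hτ.le] at hchord
  · have hchord := (hnear (right_mem_Icc.2 (by linarith))).2.2
    rwa [hβx, add_sub_cancel_left, Real.norm_of_nonneg hτ.le] at hchord

theorem eventually_exists_isNullRay [FiniteDimensional ℝ E] {β : ℝ → E} {t₀ r : ℝ}
    (hG : ContDiffAt ℝ 2 G x₀) (hL : ∀ᶠ y in 𝓝 x₀, IsLorentzForm (G y)) (hT : G x₀ T T < 0)
    (hβ : HasStrictDerivAt β T t₀) (hS : Filter.Tendsto β (𝓝 t₀) (𝓝[S] x₀)) (hr : 0 < r) :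
    ∀ᶠ q in 𝓝 x₀, q ∉ S → ∃ u w, IsNullRay G T (ball x₀ r) S q u w := by
  have := FiniteDimensional.complete ℝ E
  obtain ⟨c, hc, ρ, hρ, hrad⟩ := exists_isRadarBall hG hL hT
  replace hrad := hrad.mono (min_le_left ρ r)
  obtain ⟨δ, hδ, hjoin⟩ := exists_forall_mem_ball_isSpraySolutionIn_joining
    (contDiffAt_geodesicSpray hG (isInvertible_of_injective (hL.self_of_nhds.injective hT)))
    hrad.lipschitz (lt_min hρ hr)
  obtain ⟨τ, hτ, hcont, hmem, ha, hb⟩ :=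
    exists_Icc_chord_of_hasStrictDerivAt hβ hS (ball_mem_nhds x₀ hδ) hc
  have ha' : ContinuousAt (fun q ↦ ‖q - β (t₀ - τ) - τ • T‖) x₀ := by fun_prop
  have hb' : ContinuousAt (fun q ↦ ‖β (t₀ + τ) - q - τ • T‖) x₀ := by fun_prop
  filter_upwards [ha'.eventually_lt_const ha, hb'.eventually_lt_const hb, ball_mem_nhds x₀ hδ]
    with q hqa hqb hq hqS
  obtain ⟨u, w, h⟩ := hrad.exists_isNullRay (by linarith) hcont (fun t ht ↦ (hmem t ht).1) hqS
    (fun t ht ↦ hjoin q hq _ (hmem t ht).2) hτ hqa.le hqb.le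
  exact ⟨u, w, { h with stays := fun s hs ↦ ball_subset_ball (min_le_right _ _) (h.stays s hs) }⟩

end NullRay

section CoordinateChange

variable {E : Type*} [NormedAddCommGroup E] [NormedSpace ℝ E]
  {G G' : E → E →L[ℝ] E →L[ℝ] ℝ} {ψ : E → E} {y : E}

theorem fderiv_apply_apply (hG : DifferentiableAt ℝ G y) (a b w : E) :
    fderiv ℝ (fun z ↦ G z b w) y a = fderiv ℝ G y a b w := by
  rw [((hG.hasFDerivAt.clm_apply (hasFDerivAt_const b y)).clm_apply
    (hasFDerivAt_const w y)).fderiv]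
  simp

theorem fderiv_pullback_apply (hG : DifferentiableAt ℝ G y) (hG' : DifferentiableAt ℝ G' (ψ y))
    (hψ : ContDiffAt ℝ 2 ψ y)
    (h : ∀ᶠ z in 𝓝 y, G z = (G' (ψ z)).bilinearComp (fderiv ℝ ψ z) (fderiv ℝ ψ z)) (a b w : E) :
    fderiv ℝ G y a b w =
      fderiv ℝ G' (ψ y) (fderiv ℝ ψ y a) (fderiv ℝ ψ y b) (fderiv ℝ ψ y w)
      + G' (ψ y) (fderiv ℝ (fderiv ℝ ψ) y a b) (fderiv ℝ ψ y w)
      + G' (ψ y) (fderiv ℝ ψ y b) (fderiv ℝ (fderiv ℝ ψ) y a w) := by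
  have hψ₁ : HasFDerivAt ψ (fderiv ℝ ψ y) y := (hψ.differentiableAt (by norm_num)).hasFDerivAt
  have hψ₂ : HasFDerivAt (fderiv ℝ ψ) (fderiv ℝ (fderiv ℝ ψ) y) y :=
    ((hψ.fderiv_right (m := 1) (by norm_num)).differentiableAt (by norm_num)).hasFDerivAt
  have hpull : (fun z ↦ G z b w) =ᶠ[𝓝 y]
      fun z ↦ G' (ψ z) (fderiv ℝ ψ z b) (fderiv ℝ ψ z w) := h.mono fun z hz ↦ by simp [hz]
  have hG'ψ : HasFDerivAt (fun z ↦ G' (ψ z)) (fderiv ℝ G' (ψ y) ∘L fderiv ℝ ψ y) y :=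
    hG'.hasFDerivAt.comp y hψ₁
  rw [← fderiv_apply_apply hG, hpull.fderiv_eq,
    ((hG'ψ.clm_apply (hψ₂.clm_apply (hasFDerivAt_const b y))).clm_apply
      (hψ₂.clm_apply (hasFDerivAt_const w y))).fderiv]
  simp only [ContinuousLinearMap.comp_zero, zero_add, ContinuousLinearMap.flip_add, add_apply,
    ContinuousLinearMap.comp_apply, ContinuousLinearMap.flip_apply]
  ring

theorem apply_add_metricChristoffel_pullback (hG : DifferentiableAt ℝ G y)
    (hG' : DifferentiableAt ℝ G' (ψ y)) (hψ : ContDiffAt ℝ 2 ψ y)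
    (hsymm : ∀ v w, G' (ψ y) v w = G' (ψ y) w v)
    (h : ∀ᶠ z in 𝓝 y, G z = (G' (ψ z)).bilinearComp (fderiv ℝ ψ z) (fderiv ℝ ψ z)) (a b x : E) :
    G y b x + metricChristoffel G y a a x =
      G' (ψ y) (fderiv ℝ (fderiv ℝ ψ) y a a + fderiv ℝ ψ y b) (fderiv ℝ ψ y x)
        + metricChristoffel G' (ψ y) (fderiv ℝ ψ y a) (fderiv ℝ ψ y a) (fderiv ℝ ψ y x) := by
  have hsecond : fderiv ℝ (fderiv ℝ ψ) y x a = fderiv ℝ (fderiv ℝ ψ) y a x :=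
    (hψ.isSymmSndFDerivAt (by simp)).eq x a
  simp only [metricChristoffel, fderiv_pullback_apply hG hG' hψ h, h.self_of_nhds, hsecond,
    ContinuousLinearMap.bilinearComp_apply, map_add, add_apply,
    hsymm (fderiv ℝ (fderiv ℝ ψ) y a x)]
  ring

variable {u w : ℝ → E} {J : Set ℝ} {s : ℝ}

theorem derivWithin_derivWithin_comp {a : E} (hJ : UniqueDiffOn ℝ J) (hs : s ∈ J)
    (hu : ∀ r ∈ J, HasDerivWithinAt u (w r) J r) (hw : HasDerivWithinAt w a J s)
    (hψ : ContDiffAt ℝ 2 ψ (u s)) :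
    derivWithin (derivWithin (ψ ∘ u) J) J s =
      fderiv ℝ (fderiv ℝ ψ) (u s) (w s) (w s) + fderiv ℝ ψ (u s) a := by
  have hvel : derivWithin (ψ ∘ u) J =ᶠ[𝓝[J] s] fun r ↦ fderiv ℝ ψ (u r) (w r) := by
    filter_upwards [(hu s hs).continuousWithinAt.eventually (hψ.eventually (by simp)),
      self_mem_nhdsWithin] with r hψr hr
    exact ((hψr.differentiableAt two_ne_zero).hasFDerivAt.comp_hasDerivWithinAt r
      (hu r hr)).derivWithin (hJ r hr)
  have hD : HasDerivWithinAt (fun r ↦ fderiv ℝ ψ (u r)) (fderiv ℝ (fderiv ℝ ψ) (u s) (w s)) J s :=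
    ((hψ.fderiv_right (m := 1) (by norm_num)).differentiableAt
      one_ne_zero).hasFDerivAt.comp_hasDerivWithinAt s (hu s hs)
  exact ((hD.clm_apply hw).congr_of_eventuallyEq hvel
    (hvel.self_of_nhdsWithin hs)).derivWithin (hJ s hs)

theorem IsSpraySolution.geodesic_equation_comp (h : IsSpraySolution (geodesicSpray G) J u w)
    (hJ : UniqueDiffOn ℝ J) (hs : s ∈ J) (hinv : (G (u s)).IsInvertible)
    (hG : DifferentiableAt ℝ G (u s)) (hG' : DifferentiableAt ℝ G' (ψ (u s)))
    (hψ : ContDiffAt ℝ 2 ψ (u s)) (hsurj : Function.Surjective (fderiv ℝ ψ (u s)))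
    (hsymm : ∀ v w, G' (ψ (u s)) v w = G' (ψ (u s)) w v)
    (hpull : ∀ᶠ z in 𝓝 (u s), G z = (G' (ψ z)).bilinearComp (fderiv ℝ ψ z) (fderiv ℝ ψ z))
    (x : E) :
    G' (ψ (u s)) (derivWithin (derivWithin (ψ ∘ u) J) J s) x
      + metricChristoffel G' (ψ (u s)) (derivWithin (ψ ∘ u) J s) (derivWithin (ψ ∘ u) J s) x
      = 0 := by
  obtain ⟨x, rfl⟩ := hsurj x
  have hvel : derivWithin (ψ ∘ u) J s = fderiv ℝ ψ (u s) (w s) :=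
    ((hψ.differentiableAt two_ne_zero).hasFDerivAt.comp_hasDerivWithinAt s
      (h.pos s hs)).derivWithin (hJ s hs)
  rw [hvel, derivWithin_derivWithin_comp hJ hs h.pos (h.vel s hs) hψ,
    ← apply_add_metricChristoffel_pullback hG hG' hψ hsymm hpull]
  exact (geodesicSpray_eq_iff hinv _ _).2 rfl x

end CoordinateChange

section ChartDerivative

local notation "𝔼" n:max => EuclideanSpace ℝ (Fin n)

variable {n : ℕ} {M : Type*} [TopologicalSpace M] [ChartedSpace (𝔼 n) M]
  {x₀ x₁ : M} {y : 𝔼 n}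

theorem eventually_symm_mem_source (hy : y ∈ (extChartAt (𝓡 n) x₀).target)
    (hy' : (extChartAt (𝓡 n) x₀).symm y ∈ (extChartAt (𝓡 n) x₁).source) :
    ∀ᶠ z in 𝓝 y, z ∈ (extChartAt (𝓡 n) x₀).target ∧
      (extChartAt (𝓡 n) x₀).symm z ∈ (extChartAt (𝓡 n) x₁).source :=
  ((isOpen_extChartAt_target x₀).eventually_mem hy).and
    ((continuousAt_extChartAt_symm'' hy).eventually_mem
      ((isOpen_extChartAt_source x₁).mem_nhds hy'))

variable [IsManifold (𝓡 n) ∞ M]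

/-- The derivative of the inverse of the chart around `x₀`, as an endomorphism of the model space:
it sends coordinates of tangent vectors to tangent vectors. -/
noncomputable def chartSymmDeriv (x₀ : M) (y : 𝔼 n) : 𝔼 n →L[ℝ] 𝔼 n :=
  mfderiv 𝓘(ℝ, 𝔼 n) (𝓡 n) (extChartAt (𝓡 n) x₀).symm y

theorem hasMFDerivAt_extChartAt_symm (hy : y ∈ (extChartAt (𝓡 n) x₀).target) :
    HasMFDerivAt 𝓘(ℝ, 𝔼 n) (𝓡 n) (extChartAt (𝓡 n) x₀).symm y (chartSymmDeriv x₀ y) :=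
  (((contMDiffOn_extChartAt_symm (n := ∞) x₀).contMDiffAt
    ((isOpen_extChartAt_target x₀).mem_nhds hy)).mdifferentiableAt (by simp)).hasMFDerivAt

theorem bijective_chartSymmDeriv (hy : y ∈ (extChartAt (𝓡 n) x₀).target) :
    Function.Bijective (chartSymmDeriv x₀ y) := by
  have h := isInvertible_mfderivWithin_extChartAt_symm hy
  simp only [modelWithCornersSelf_coe, range_id, mfderivWithin_univ] at h
  exact h.bijective

theorem symmL_trivializationAt_eq_chartSymmDeriv {x : M}
    (hx : x ∈ (extChartAt (𝓡 n) x₀).source) :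
    (trivializationAt (𝔼 n) (TangentSpace (𝓡 n)) x₀).symmL ℝ x =
      chartSymmDeriv x₀ (extChartAt (𝓡 n) x₀ x) := by
  have h := TangentBundle.symmL_trivializationAt (𝕜 := ℝ) (I := 𝓡 n) (x₀ := x₀) (x := x)
    (by simpa using hx)
  simp only [modelWithCornersSelf_coe, range_id, mfderivWithin_univ] at h
  exact h

/-- The change of coordinates from the chart around `x₀` to the chart around `x₁`. -/
noncomputable def chartTransition (x₀ x₁ : M) (y : 𝔼 n) : 𝔼 n :=
  extChartAt (𝓡 n) x₁ ((extChartAt (𝓡 n) x₀).symm y)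

theorem contDiffAt_chartTransition (hy : y ∈ (extChartAt (𝓡 n) x₀).target)
    (hy' : (extChartAt (𝓡 n) x₀).symm y ∈ (extChartAt (𝓡 n) x₁).source) :
    ContDiffAt ℝ ∞ (chartTransition x₀ x₁) y := by
  have hsymm : ContMDiffAt 𝓘(ℝ, 𝔼 n) (𝓡 n) ∞ (extChartAt (𝓡 n) x₀).symm y :=
    (contMDiffOn_extChartAt_symm x₀).contMDiffAt ((isOpen_extChartAt_target x₀).mem_nhds hy)
  have hchart : ContMDiffAt (𝓡 n) 𝓘(ℝ, 𝔼 n) ∞ (extChartAt (𝓡 n) x₁)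
      ((extChartAt (𝓡 n) x₀).symm y) := contMDiffAt_extChartAt' (by simpa using hy')
  exact (hchart.comp y hsymm).contDiffAt

theorem chartSymmDeriv_comp_fderiv_chartTransition (hy : y ∈ (extChartAt (𝓡 n) x₀).target)
    (hy' : (extChartAt (𝓡 n) x₀).symm y ∈ (extChartAt (𝓡 n) x₁).source) :
    chartSymmDeriv x₁ (chartTransition x₀ x₁ y) ∘L fderiv ℝ (chartTransition x₀ x₁) y =
      chartSymmDeriv x₀ y := by
  have htrans : HasMFDerivAt 𝓘(ℝ, 𝔼 n) 𝓘(ℝ, 𝔼 n) (chartTransition x₀ x₁) y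
      (fderiv ℝ (chartTransition x₀ x₁) y) :=
    ((contDiffAt_chartTransition hy hy').differentiableAt
      (by simp)).hasFDerivAt.hasMFDerivAt
  have hcomp := (hasMFDerivAt_extChartAt_symm
    ((extChartAt (𝓡 n) x₁).map_source hy')).comp y htrans
  refine hasMFDerivAt_unique (hcomp.congr_of_eventuallyEq ?_) (hasMFDerivAt_extChartAt_symm hy)
  filter_upwards [eventually_symm_mem_source hy hy'] with z hz
  exact ((extChartAt (𝓡 n) x₁).left_inv hz.2).symm

theorem surjective_fderiv_chartTransition (hy : y ∈ (extChartAt (𝓡 n) x₀).target)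
    (hy' : (extChartAt (𝓡 n) x₀).symm y ∈ (extChartAt (𝓡 n) x₁).source) :
    Function.Surjective (fderiv ℝ (chartTransition x₀ x₁) y) := by
  have hcomp := chartSymmDeriv_comp_fderiv_chartTransition hy hy'
  have hsurj : Function.Surjective (chartSymmDeriv x₁ (chartTransition x₀ x₁ y) ∘
      fderiv ℝ (chartTransition x₀ x₁) y) := by
    rw [← ContinuousLinearMap.coe_comp, hcomp]
    exact (bijective_chartSymmDeriv hy).2
  exact hsurj.of_comp_left
    (bijective_chartSymmDeriv ((extChartAt (𝓡 n) x₁).map_source hy')).1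

end ChartDerivative

section ChartMetric

local notation "𝔼" => EuclideanSpace ℝ (Fin 4)

variable {M : Type*} [TopologicalSpace M] [ChartedSpace 𝔼 M] [IsManifold (𝓡 4) ∞ M]

namespace LorentzMetric

/-- The metric at `x` as a bilinear form on the model space, which is definitionally the tangent
space. -/
def form (g : LorentzMetric M) (x : M) : 𝔼 →L[ℝ] 𝔼 →L[ℝ] ℝ := g.val x

/-- The metric in the chart around `x₀` as a field of bilinear forms: the bundled form of
`LorentzMetric.inChart`. -/
noncomputable def chartMetric (g : LorentzMetric M) (x₀ : M) (y : 𝔼) : 𝔼 →L[ℝ] 𝔼 →L[ℝ] ℝ :=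
  (g.form ((extChartAt (𝓡 4) x₀).symm y)).bilinearComp (chartSymmDeriv x₀ y) (chartSymmDeriv x₀ y)

variable (g : LorentzMetric M) {x₀ x₁ x : M} {y : 𝔼}

theorem chartMetric_apply (x₀ : M) (y v w : 𝔼) :
    g.chartMetric x₀ y v w = g.inChart x₀ y v w := rfl

theorem form_chartSymmDeriv (hx : x ∈ (extChartAt (𝓡 4) x₀).source) (v w : 𝔼) :
    g.form x (chartSymmDeriv x₀ (extChartAt (𝓡 4) x₀ x) v)
      (chartSymmDeriv x₀ (extChartAt (𝓡 4) x₀ x) w) =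
      g.chartMetric x₀ (extChartAt (𝓡 4) x₀ x) v w := by
  rw [chartMetric, ContinuousLinearMap.bilinearComp_apply, (extChartAt (𝓡 4) x₀).left_inv hx]

theorem isLorentzForm_form (x : M) : IsLorentzForm (g.form x) :=
  let ⟨b, hb⟩ := g.lorentzian x
  IsLorentzForm.of_basis b hb

theorem isLorentzForm_chartMetric (hy : y ∈ (extChartAt (𝓡 4) x₀).target) :
    IsLorentzForm (g.chartMetric x₀ y) :=
  (g.isLorentzForm_form _).bilinearComp (bijective_chartSymmDeriv hy).1

theorem isInvertible_chartMetric (hy : y ∈ (extChartAt (𝓡 4) x₀).target) :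
    (g.chartMetric x₀ y).IsInvertible := by
  obtain ⟨b, hb⟩ := g.lorentzian ((extChartAt (𝓡 4) x₀).symm y)
  obtain ⟨T, hT⟩ := (bijective_chartSymmDeriv hy).2 (b 0)
  have hTT : g.chartMetric x₀ y T T = g.val _ (b 0) (b 0) :=
    congrArg₂ (fun v w ↦ g.form ((extChartAt (𝓡 4) x₀).symm y) v w) hT hT
  refine isInvertible_of_injective ((g.isLorentzForm_chartMetric hy).injective (T := T) ?_)
  rw [hTT, hb]
  simp

theorem contMDiffAt_val_symmL
    (hx : x ∈ (trivializationAt 𝔼 (TangentSpace (𝓡 4)) x₀).baseSet) (a b : 𝔼) :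
    ContMDiffAt (𝓡 4) 𝓘(ℝ, ℝ) ∞ (fun x ↦ g.val x
      ((trivializationAt 𝔼 (TangentSpace (𝓡 4)) x₀).symmL ℝ x a)
      ((trivializationAt 𝔼 (TangentSpace (𝓡 4)) x₀).symmL ℝ x b)) x := by
  set e := trivializationAt 𝔼 (TangentSpace (𝓡 4)) x₀
  have hfield (a : 𝔼) : ContMDiffAt (𝓡 4) ((𝓡 4).prod 𝓘(ℝ, 𝔼)) ∞
      (fun x ↦ TotalSpace.mk' 𝔼 (E := TangentSpace (𝓡 4)) x (e.symmL ℝ x a)) x :=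
    (e.contMDiffAt_symmL (n := ∞) hx).clm_bundle_apply
      (E₁ := Bundle.Trivial M 𝔼) (v := fun _ ↦ a) ((contMDiffAt_section _).2 contMDiffAt_const)
  exact (contMDiffAt_section (E := Bundle.Trivial M ℝ) x).1
    (ContMDiffAt.clm_bundle_apply₂ (g.smooth x) (hfield a) (hfield b))

theorem contDiffOn_chartMetric (x₀ : M) :
    ContDiffOn ℝ ∞ (g.chartMetric x₀) (extChartAt (𝓡 4) x₀).target := by
  simp only [contDiffOn_clm_apply]
  intro a b
  have hcoeff : ContMDiffOn (𝓡 4) 𝓘(ℝ, ℝ) ∞ _ (extChartAt (𝓡 4) x₀).source := fun x hx ↦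
    (g.contMDiffAt_val_symmL (x₀ := x₀) (by simpa using hx) a b).contMDiffWithinAt
  refine (hcoeff.comp (contMDiffOn_extChartAt_symm x₀)
    (extChartAt (𝓡 4) x₀).mapsTo_symm).contDiffOn.congr fun y hy ↦ ?_
  have hx := (extChartAt (𝓡 4) x₀).map_target hy
  rw [Function.comp_apply, symmL_trivializationAt_eq_chartSymmDeriv hx,
    (extChartAt (𝓡 4) x₀).right_inv hy]
  rfl

theorem contDiffAt_chartMetric (hy : y ∈ (extChartAt (𝓡 4) x₀).target) :
    ContDiffAt ℝ ∞ (g.chartMetric x₀) y :=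
  (g.contDiffOn_chartMetric x₀).contDiffAt ((isOpen_extChartAt_target x₀).mem_nhds hy)

theorem christoffel_eq_metricChristoffel (hy : y ∈ (extChartAt (𝓡 4) x₀).target) (a b w : 𝔼) :
    g.christoffel x₀ y a b w = metricChristoffel (g.chartMetric x₀) y a b w := by
  have hd : DifferentiableAt ℝ (g.chartMetric x₀) y :=
    (g.contDiffAt_chartMetric hy).differentiableAt (by simp)
  simp only [christoffel, metricChristoffel, ← fderiv_apply_apply hd, chartMetric_apply]

theorem chartMetric_eq_bilinearComp (hy : y ∈ (extChartAt (𝓡 4) x₀).target)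
    (hy' : (extChartAt (𝓡 4) x₀).symm y ∈ (extChartAt (𝓡 4) x₁).source) :
    g.chartMetric x₀ y = (g.chartMetric x₁ (chartTransition x₀ x₁ y)).bilinearComp
      (fderiv ℝ (chartTransition x₀ x₁) y) (fderiv ℝ (chartTransition x₀ x₁) y) := by
  ext v w
  simp only [chartMetric, ContinuousLinearMap.bilinearComp_apply,
    ← chartSymmDeriv_comp_fderiv_chartTransition hy hy', ContinuousLinearMap.comp_apply]
  rw [chartTransition, (extChartAt (𝓡 4) x₁).left_inv hy']

theorem isGeodesicOn_of_isSpraySolution {J : Set ℝ} {u w : ℝ → 𝔼} (hJ : UniqueDiffOn ℝ J)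
    (hu : IsSpraySolution (geodesicSpray (g.chartMetric x₀)) J u w)
    (hmem : MapsTo u J (extChartAt (𝓡 4) x₀).target) :
    g.IsGeodesicOn (fun s ↦ (extChartAt (𝓡 4) x₀).symm (u s)) J := by
  have hspray : ContinuousOn (fun s ↦ geodesicSpray (g.chartMetric x₀) (u s)) J := fun s hs ↦
    (contDiffAt_geodesicSpray ((g.contDiffAt_chartMetric (hmem hs)).of_le ENat.LEInfty.out)
      (g.isInvertible_chartMetric (hmem hs))).continuousAt.comp_continuousWithinAt
      (hu.pos s hs).continuousWithinAt
  refine ⟨((contMDiffOn_extChartAt_symm (n := ∞) x₀).of_le ENat.LEInfty.out).comp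
    (hu.contDiffOn_two hJ hspray).contMDiffOn hmem, fun x₁ s hs hs₁ ↦ ?_⟩
  have htarget : chartTransition x₀ x₁ (u s) ∈ (extChartAt (𝓡 4) x₁).target :=
    (extChartAt (𝓡 4) x₁).map_source hs₁
  intro v v' v'' x
  change g.chartMetric x₁ (chartTransition x₀ x₁ (u s)) _ _ +
    g.christoffel x₁ (chartTransition x₀ x₁ (u s)) _ _ _ = 0
  rw [g.christoffel_eq_metricChristoffel htarget]
  exact hu.geodesic_equation_comp hJ hs (g.isInvertible_chartMetric (hmem hs))
    ((g.contDiffAt_chartMetric (hmem hs)).differentiableAt (by simp))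
    ((g.contDiffAt_chartMetric htarget).differentiableAt (by simp))
    ((contDiffAt_chartTransition (hmem hs) hs₁).of_le ENat.LEInfty.out)
    (surjective_fderiv_chartTransition (hmem hs) hs₁)
    (g.isLorentzForm_chartMetric htarget).symm
    ((eventually_symm_mem_source (hmem hs) hs₁).mono fun z hz ↦
      g.chartMetric_eq_bilinearComp hz.1 hz.2) x

theorem IsGeodesicOn.isSpraySolution {g : LorentzMetric M} {J : Set ℝ} {c : ℝ → M}
    (hc : g.IsGeodesicOn c J) (hJ : UniqueDiffOn ℝ J)
    (hmem : MapsTo c J (extChartAt (𝓡 4) x₀).source) :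
    IsSpraySolution (geodesicSpray (g.chartMetric x₀)) J (fun s ↦ extChartAt (𝓡 4) x₀ (c s))
      (derivWithin (fun s ↦ extChartAt (𝓡 4) x₀ (c s)) J) := by
  have hu : ContDiffOn ℝ (1 + 1) (fun s ↦ extChartAt (𝓡 4) x₀ (c s)) J :=
    (((contMDiffOn_extChartAt (n := ∞)).of_le ENat.LEInfty.out).comp hc.1
      fun s hs ↦ by simpa using hmem hs).contDiffOn
  refine ⟨fun s hs ↦ (hu.differentiableOn (by simp) s hs).hasDerivWithinAt, fun s hs ↦ ?_⟩
  have htarget := (extChartAt (𝓡 4) x₀).map_source (hmem hs)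
  rw [← (geodesicSpray_eq_iff (g.isInvertible_chartMetric htarget) _ _).1 fun x ↦ by
    rw [← g.christoffel_eq_metricChristoffel htarget]
    exact hc.2 x₀ s hs (hmem hs) x]
  exact (((contDiffOn_succ_iff_derivWithin hJ).1 hu).2.2.differentiableOn one_ne_zero s
    hs).hasDerivWithinAt

end LorentzMetric

section Velocity

variable {J : Set ℝ} {s : ℝ} {x₀ : M}

theorem velocity_extChartAt_symm {u : ℝ → 𝔼} {w : 𝔼} (hu : HasDerivWithinAt u w J s)
    (hJ : UniqueDiffWithinAt ℝ J s) (hy : u s ∈ (extChartAt (𝓡 4) x₀).target) :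
    velocity (fun r ↦ (extChartAt (𝓡 4) x₀).symm (u r)) J s = chartSymmDeriv x₀ (u s) w := by
  have hcomp := (hasMFDerivAt_extChartAt_symm hy).comp_hasMFDerivWithinAt s
    hu.hasFDerivWithinAt.hasMFDerivWithinAt
  have happly := DFunLike.congr_fun (hcomp.mfderivWithin hJ.uniqueMDiffWithinAt) (1 : ℝ)
  exact happly.trans (congrArg (chartSymmDeriv x₀ (u s)) (one_smul ℝ w))

theorem velocity_eq_chartSymmDeriv {c : ℝ → M} {w : 𝔼} (hc : ContinuousWithinAt c J s) (hs : s ∈ J)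
    (hJ : UniqueDiffWithinAt ℝ J s) (hx : c s ∈ (extChartAt (𝓡 4) x₀).source)
    (hw : HasDerivWithinAt (fun r ↦ extChartAt (𝓡 4) x₀ (c r)) w J s) :
    velocity c J s = chartSymmDeriv x₀ (extChartAt (𝓡 4) x₀ (c s)) w := by
  have hcongr : c =ᶠ[𝓝[J] s] fun r ↦ (extChartAt (𝓡 4) x₀).symm (extChartAt (𝓡 4) x₀ (c r)) := by
    filter_upwards [hc.preimage_mem_nhdsWithin
      ((isOpen_extChartAt_source x₀).mem_nhds hx)] with r hr
    exact ((extChartAt (𝓡 4) x₀).left_inv hr).symm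
  exact (DFunLike.congr_fun (hcongr.mfderivWithin_eq (hcongr.self_of_nhdsWithin hs)) (1 : ℝ)).trans
    (velocity_extChartAt_symm hw hJ ((extChartAt (𝓡 4) x₀).map_source hx))

end Velocity

end ChartMetric

section LightRays

local notation "𝔼" => EuclideanSpace ℝ (Fin 4)

variable {M : Type*} [TopologicalSpace M] [ChartedSpace 𝔼 M]

/-- The points of the chart domain around `x₀` whose coordinates have distance less than `r` from
those of `x₀`: the neighborhoods of `x₀` in which light rays are studied. -/
def chartBall (x₀ : M) (r : ℝ) : Set M :=
  (extChartAt (𝓡 4) x₀).source ∩ extChartAt (𝓡 4) x₀ ⁻¹' ball (extChartAt (𝓡 4) x₀ x₀) r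

theorem isOpen_chartBall (x₀ : M) (r : ℝ) : IsOpen (chartBall x₀ r) :=
  (continuousOn_extChartAt x₀).isOpen_inter_preimage (isOpen_extChartAt_source x₀) isOpen_ball

theorem mem_chartBall_self (x₀ : M) {r : ℝ} (hr : 0 < r) : x₀ ∈ chartBall x₀ r :=
  ⟨mem_extChartAt_source x₀, mem_ball_self hr⟩

theorem eventually_mem_extChartAt_target (x₀ : M) :
    ∀ᶠ y in 𝓝 (extChartAt (𝓡 4) x₀ x₀), y ∈ (extChartAt (𝓡 4) x₀).target :=
  (isOpen_extChartAt_target x₀).eventually_mem (mem_extChartAt_target x₀)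

theorem map_extChartAt_comp_of_isInducing {I : Set ℝ} {γ : ℝ → M} {t₀ : ℝ}
    (hγ : Topology.IsInducing fun t : I ↦ γ t) (ht₀ : I ∈ 𝓝 t₀) :
    Filter.map (fun t ↦ extChartAt (𝓡 4) (γ t₀) (γ t)) (𝓝 t₀) =
      𝓝[(extChartAt (𝓡 4) (γ t₀)).symm ⁻¹' (γ '' I)] extChartAt (𝓡 4) (γ t₀) (γ t₀) := by
  have hcurve : Filter.map γ (𝓝 t₀) = 𝓝[γ '' I] γ t₀ := by
    have hmap := hγ.map_nhds_eq ⟨t₀, mem_of_mem_nhds ht₀⟩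
    rw [show (fun t : I ↦ γ t) = γ ∘ Subtype.val from rfl, ← Filter.map_map,
      map_nhds_subtype_val, nhdsWithin_eq_nhds.2 ht₀, range_comp, Subtype.range_coe] at hmap
    exact hmap
  rw [show (fun t ↦ extChartAt (𝓡 4) (γ t₀) (γ t)) = extChartAt (𝓡 4) (γ t₀) ∘ γ from rfl,
    ← Filter.map_map, hcurve, map_extChartAt_nhdsWithin]
  simp only [modelWithCornersSelf_coe, range_id, inter_univ]

variable [IsManifold (𝓡 4) ∞ M]

/-- The light rays whose velocities satisfy the predicate `F`, for instance the future-pointing or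
the past-pointing ones. -/
def LorentzMetric.IsDirectedLightRay (g : LorentzMetric M)
    (F : ∀ x : M, TangentSpace (𝓡 4) x → Prop) (V : Set M) (q : M) (S : Set M) (c : ℝ → M) : Prop :=
  g.IsLightRayWithin V q S c ∧ ∀ s ∈ Icc (0 : ℝ) 1, F (c s) (velocity c (Icc 0 1) s)

/-- At the point with coordinates `y`, the predicate `F` singles out the causal vectors in the time
cone of the timelike coordinate vector `T`. -/
def LorentzMetric.IsCausalConeAt (g : LorentzMetric M) (x₀ : M)
    (F : ∀ x : M, TangentSpace (𝓡 4) x → Prop) (T y : 𝔼) : Prop :=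
  ∀ v : 𝔼, F ((extChartAt (𝓡 4) x₀).symm y) (chartSymmDeriv x₀ y v) ↔
    g.chartMetric x₀ y v v ≤ 0 ∧ g.chartMetric x₀ y T v < 0

variable {g : LorentzMetric M} {F : ∀ x : M, TangentSpace (𝓡 4) x → Prop} {x₀ q : M} {S : Set M}
  {T : 𝔼} {r : ℝ}

theorem LorentzMetric.IsCausalConeAt.apply_iff {x : M}
    (hF : g.IsCausalConeAt x₀ F T (extChartAt (𝓡 4) x₀ x))
    (hx : x ∈ (extChartAt (𝓡 4) x₀).source) (v : 𝔼) :
    F x (chartSymmDeriv x₀ (extChartAt (𝓡 4) x₀ x) v) ↔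
      g.chartMetric x₀ (extChartAt (𝓡 4) x₀ x) v v ≤ 0 ∧
        g.chartMetric x₀ (extChartAt (𝓡 4) x₀ x) T v < 0 := by
  have hv := hF v
  rwa [(extChartAt (𝓡 4) x₀).left_inv hx] at hv

theorem LorentzMetric.IsDirectedLightRay.isNullRay {c : ℝ → M}
    (hc : g.IsDirectedLightRay F (chartBall x₀ r) q S c)
    (hF : ∀ y ∈ ball (extChartAt (𝓡 4) x₀ x₀) r, g.IsCausalConeAt x₀ F T y) :
    IsNullRay (g.chartMetric x₀) T (ball (extChartAt (𝓡 4) x₀ x₀) r)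
      ((extChartAt (𝓡 4) x₀).symm ⁻¹' S) (extChartAt (𝓡 4) x₀ q)
      (fun s ↦ extChartAt (𝓡 4) x₀ (c s))
      (derivWithin (fun s ↦ extChartAt (𝓡 4) x₀ (c s)) (Icc 0 1)) := by
  obtain ⟨hray, hdir⟩ := hc
  have huniq : UniqueDiffOn ℝ (Icc (0 : ℝ) 1) := uniqueDiffOn_Icc zero_lt_one
  have hsource : MapsTo c (Icc 0 1) (extChartAt (𝓡 4) x₀).source := fun s hs ↦ (hray.stays s hs).1
  have hspray := hray.geodesic.isSpraySolution huniq hsource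
  have hvel s (hs : s ∈ Icc (0 : ℝ) 1) := velocity_eq_chartSymmDeriv
    (hray.geodesic.1 s hs).continuousWithinAt hs (huniq s hs) (hsource hs) (hspray.pos s hs)
  refine ⟨hspray, fun s hs ↦ ?_, fun s hs ↦ ?_, congrArg _ hray.start, ?_,
    fun s hs ↦ (hray.stays s hs).2⟩
  · have hnull := (hray.lightlike s hs).2
    rw [hvel s hs] at hnull
    rw [← g.form_chartSymmDeriv (hsource hs)]
    exact hnull
  · have hfut := hdir s hs
    rw [hvel s hs, (hF _ (hray.stays s hs).2).apply_iff (hsource hs)] at hfut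
    exact hfut.2
  · rw [mem_preimage, (extChartAt (𝓡 4) x₀).left_inv (hsource (right_mem_Icc.2 zero_le_one))]
    exact hray.finish

theorem IsNullRay.isDirectedLightRay {u w : ℝ → 𝔼}
    (h : IsNullRay (g.chartMetric x₀) T (ball (extChartAt (𝓡 4) x₀ x₀) r)
      ((extChartAt (𝓡 4) x₀).symm ⁻¹' S) (extChartAt (𝓡 4) x₀ q) u w)
    (hF : ∀ y ∈ ball (extChartAt (𝓡 4) x₀ x₀) r, g.IsCausalConeAt x₀ F T y)
    (hball : ball (extChartAt (𝓡 4) x₀ x₀) r ⊆ (extChartAt (𝓡 4) x₀).target)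
    (hq : q ∈ (extChartAt (𝓡 4) x₀).source) :
    g.IsDirectedLightRay F (chartBall x₀ r) q S (fun s ↦ (extChartAt (𝓡 4) x₀).symm (u s)) := by
  have huniq : UniqueDiffOn ℝ (Icc (0 : ℝ) 1) := uniqueDiffOn_Icc zero_lt_one
  have htarget : MapsTo u (Icc 0 1) (extChartAt (𝓡 4) x₀).target := fun s hs ↦
    hball (h.stays s hs)
  have hvel s (hs : s ∈ Icc (0 : ℝ) 1) :=
    velocity_extChartAt_symm (h.pos s hs) (huniq s hs) (htarget hs)
  refine ⟨⟨g.isGeodesicOn_of_isSpraySolution huniq h.toIsSpraySolution htarget,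
    fun s hs ↦ ⟨?_, ?_⟩, ?_, h.finish,
    fun s hs ↦ ⟨(extChartAt (𝓡 4) x₀).map_target (htarget hs), ?_⟩⟩, fun s hs ↦ ?_⟩
  · rw [hvel s hs]
    refine (map_ne_zero_iff _ (bijective_chartSymmDeriv (htarget hs)).1).2 fun hw ↦ ?_
    simpa [hw] using h.future s hs
  · rw [hvel s hs]
    exact h.null s hs
  · rw [h.start, (extChartAt (𝓡 4) x₀).left_inv hq]
  · rw [mem_preimage, (extChartAt (𝓡 4) x₀).right_inv (htarget hs)]
    exact h.stays s hs
  · rw [hvel s hs]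
    exact (hF _ (h.stays s hs) _).2 ⟨(h.null s hs).le, h.future s hs⟩

theorem LorentzMetric.eventually_existsUnique_isDirectedLightRay {β : ℝ → 𝔼} {t₀ : ℝ}
    (hF : ∀ᶠ y in 𝓝 (extChartAt (𝓡 4) x₀ x₀), g.IsCausalConeAt x₀ F T y)
    (hT : g.chartMetric x₀ (extChartAt (𝓡 4) x₀ x₀) T T < 0) (hβ : HasStrictDerivAt β T t₀)
    (hS : Filter.map β (𝓝 t₀) =
      𝓝[(extChartAt (𝓡 4) x₀).symm ⁻¹' S] extChartAt (𝓡 4) x₀ x₀) :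
    ∀ᶠ r in 𝓝[>] (0 : ℝ), ∀ᶠ q in 𝓝 x₀, q ∉ S →
      ∃ c, g.IsDirectedLightRay F (chartBall x₀ r) q S c ∧
        ∀ c', g.IsDirectedLightRay F (chartBall x₀ r) q S c' → EqOn c' c (Icc 0 1) := by
  have hG := (g.contDiffAt_chartMetric (mem_extChartAt_target x₀)).of_le
    (show (2 : ℕ∞ω) ≤ ∞ from ENat.LEInfty.out)
  have hL := (eventually_mem_extChartAt_target x₀).mono fun y hy ↦ g.isLorentzForm_chartMetric hy
  obtain ⟨R, hR, hgood⟩ :=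
    Metric.eventually_nhds_iff_ball.1 ((eventually_mem_extChartAt_target x₀).and hF)
  filter_upwards [eventually_eqOn_of_isNullRay hG hL hT hβ hS, Ioo_mem_nhdsGT hR]
    with r hunique hr
  have hsub : ball (extChartAt (𝓡 4) x₀ x₀) r ⊆ ball (extChartAt (𝓡 4) x₀ x₀) R :=
    ball_subset_ball hr.2.le
  have hcone y hy := (hgood y (hsub hy)).2
  filter_upwards [(continuousAt_extChartAt x₀).eventually
    (eventually_exists_isNullRay hG hL hT hβ hS.le hr.1), extChartAt_source_mem_nhds (I := 𝓡 4) x₀]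
    with q hexists hq hqS
  obtain ⟨u, w, huw⟩ := hexists (by rwa [mem_preimage, (extChartAt (𝓡 4) x₀).left_inv hq])
  refine ⟨_, huw.isDirectedLightRay hcone (fun y hy ↦ (hgood y (hsub hy)).1) hq,
    fun c' hc' s hs ↦ ?_⟩
  rw [← hunique (hc'.isNullRay hcone) huw hs, (extChartAt (𝓡 4) x₀).left_inv (hc'.1.stays s hs).1]

end LightRays

section Orientation

local notation "𝔼" => EuclideanSpace ℝ (Fin 4)

variable {M : Type*} [TopologicalSpace M] [ChartedSpace 𝔼 M] [IsManifold (𝓡 4) ∞ M]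

theorem exists_continuousAt_chartSymmDeriv_eq {x₀ : M} {X : ∀ x : M, TangentSpace (𝓡 4) x}
    (hX : ContinuousAt (fun x ↦ (⟨x, X x⟩ : TangentBundle (𝓡 4) M)) x₀) :
    ∃ ξ : M → 𝔼, ContinuousAt ξ x₀ ∧ ∀ x ∈ (extChartAt (𝓡 4) x₀).source,
      chartSymmDeriv x₀ (extChartAt (𝓡 4) x₀ x) (ξ x) = X x := by
  set e := trivializationAt 𝔼 (TangentSpace (𝓡 4)) x₀
  have hx₀ : x₀ ∈ e.baseSet := FiberBundle.mem_baseSet_trivializationAt' x₀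
  refine ⟨fun x ↦ (e ⟨x, X x⟩).2, continuousAt_snd.comp
    ((e.continuousAt (e.mem_source.2 hx₀)).comp_of_eq hX rfl), fun x hx ↦ ?_⟩
  have hxe : x ∈ e.baseSet := by simpa [e] using hx
  have hsymm : e.symmL ℝ x (e ⟨x, X x⟩).2 = X x := by
    rw [← e.continuousLinearMapAt_apply_of_mem ℝ hxe, e.symmL_continuousLinearMapAt hxe]
  rw [← symmL_trivializationAt_eq_chartSymmDeriv hx]
  exact hsymm

namespace TimeOrientation

variable {g : LorentzMetric M} {τ : TimeOrientation g} {x₀ : M} {T y : 𝔼}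

theorem isCausalConeAt {X : 𝔼} (hy : y ∈ (extChartAt (𝓡 4) x₀).target)
    (hT : g.chartMetric x₀ y T T < 0)
    (hX : chartSymmDeriv x₀ y X ∈ τ.futureCone ((extChartAt (𝓡 4) x₀).symm y))
    (hXT : g.chartMetric x₀ y X T < 0) :
    g.IsCausalConeAt x₀ (fun _ v ↦ τ.FuturePointing v) T y := by
  intro v
  obtain ⟨X₀, hX₀, hcone⟩ := τ.isTimecone ((extChartAt (𝓡 4) x₀).symm y)
  have hcone' : τ.futureCone ((extChartAt (𝓡 4) x₀).symm y) =
    timecone (g.form ((extChartAt (𝓡 4) x₀).symm y)) X₀ := hcone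
  rw [hcone'] at hX
  have hfuture (hv : g.chartMetric x₀ y v v ≤ 0) :=
    (g.isLorentzForm_form _).forall_timecone_neg_iff hX₀ hX hT hXT hv
  constructor
  · rintro ⟨-, hv, hvT⟩
    rw [hcone'] at hvT
    exact ⟨hv, (hfuture hv).1 hvT⟩
  · rintro ⟨hv, hvT⟩
    refine ⟨(map_ne_zero_iff _ (bijective_chartSymmDeriv hy).1).2 ?_, hv, ?_⟩
    · rintro rfl
      simp at hvT
    · rw [hcone']
      exact (hfuture hv).2 hvT

theorem eventually_isCausalConeAt (hT : g.chartMetric x₀ (extChartAt (𝓡 4) x₀ x₀) T T < 0)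
    (hTf : τ.FuturePointing (x := x₀) (chartSymmDeriv x₀ (extChartAt (𝓡 4) x₀ x₀) T)) :
    ∀ᶠ y in 𝓝 (extChartAt (𝓡 4) x₀ x₀),
      g.IsCausalConeAt x₀ (fun _ v ↦ τ.FuturePointing v) T y := by
  obtain ⟨W, hW, X, hX, hXW⟩ := τ.consistent x₀
  obtain ⟨ξ, hξ, hξX⟩ := exists_continuousAt_chartSymmDeriv_eq (hX.continuousAt hW)
  have hsource := mem_extChartAt_source (I := 𝓡 4) x₀
  have hG := (g.contDiffAt_chartMetric (mem_extChartAt_target x₀)).continuousAt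
  have hξT₀ : g.chartMetric x₀ (extChartAt (𝓡 4) x₀ x₀) (ξ x₀) T < 0 := by
    rw [← g.form_chartSymmDeriv hsource, hξX x₀ hsource]
    exact hTf.2.2 _ (hXW x₀ (mem_of_mem_nhds hW))
  have hξT : ∀ᶠ x in 𝓝 x₀, g.chartMetric x₀ (extChartAt (𝓡 4) x₀ x) (ξ x) T < 0 :=
    (((hG.comp (continuousAt_extChartAt x₀)).clm_apply hξ).clm_apply
      continuousAt_const).eventually_lt_const hξT₀
  have hTT : ∀ᶠ y in 𝓝 (extChartAt (𝓡 4) x₀ x₀), g.chartMetric x₀ y T T < 0 :=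
    ((hG.clm_apply continuousAt_const).clm_apply continuousAt_const).eventually_lt_const hT
  have hsymm : Filter.Tendsto (extChartAt (𝓡 4) x₀).symm (𝓝 (extChartAt (𝓡 4) x₀ x₀)) (𝓝 x₀) := by
    simpa only [extChartAt_to_inv] using (continuousAt_extChartAt_symm (I := 𝓡 4) x₀).tendsto
  filter_upwards [eventually_mem_extChartAt_target x₀, hTT,
    hsymm.eventually (hξT.and (Filter.eventually_mem_set.2 hW))]
    with y hy hTy ⟨hξTy, hyW⟩
  have hξy := hξX _ ((extChartAt (𝓡 4) x₀).map_target hy)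
  rw [(extChartAt (𝓡 4) x₀).right_inv hy] at hξy hξTy
  exact isCausalConeAt hy hTy (hξy ▸ hXW _ hyW) hξTy

end TimeOrientation

theorem LorentzMetric.IsCausalConeAt.neg {g : LorentzMetric M}
    {F : ∀ x : M, TangentSpace (𝓡 4) x → Prop} {x₀ : M} {T y : 𝔼}
    (h : g.IsCausalConeAt x₀ F T y) : g.IsCausalConeAt x₀ (fun x v ↦ F x (-v)) (-T) y := by
  intro v
  have hv := h (-v)
  simp only [map_neg, neg_apply, neg_neg] at hv ⊢
  exact hv

end Orientation

section Clock

local notation "𝔼" => EuclideanSpace ℝ (Fin 4)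

variable {M : Type*} [TopologicalSpace M] [ChartedSpace 𝔼 M] [IsManifold (𝓡 4) ∞ M]

theorem LorentzMetric.eventually_existsUnique_isDirectedLightRay_neg {g : LorentzMetric M}
    {F : ∀ x : M, TangentSpace (𝓡 4) x → Prop} {x₀ : M} {S : Set M} {T : 𝔼} {β : ℝ → 𝔼} {t₀ : ℝ}
    (hF : ∀ᶠ y in 𝓝 (extChartAt (𝓡 4) x₀ x₀), g.IsCausalConeAt x₀ F T y)
    (hT : g.chartMetric x₀ (extChartAt (𝓡 4) x₀ x₀) T T < 0) (hβ : HasStrictDerivAt β T t₀)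
    (hS : Filter.map β (𝓝 t₀) =
      𝓝[(extChartAt (𝓡 4) x₀).symm ⁻¹' S] extChartAt (𝓡 4) x₀ x₀) :
    ∀ᶠ r in 𝓝[>] (0 : ℝ), ∀ᶠ q in 𝓝 x₀, q ∉ S →
      ∃ c, g.IsDirectedLightRay (fun x v ↦ F x (-v)) (chartBall x₀ r) q S c ∧
        ∀ c', g.IsDirectedLightRay (fun x v ↦ F x (-v)) (chartBall x₀ r) q S c' →
          EqOn c' c (Icc 0 1) := by
  have hneg : HasStrictDerivAt (fun t : ℝ ↦ -t) (-1) (-t₀) := (hasStrictDerivAt_id (-t₀)).neg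
  have hβ' : HasStrictDerivAt (fun t ↦ β (-t)) (-T) (-t₀) := by
    rw [← neg_one_smul ℝ T]
    exact HasStrictDerivAt.scomp (-t₀) (by rwa [neg_neg]) hneg
  have hS' : Filter.map (fun t ↦ β (-t)) (𝓝 (-t₀)) =
      𝓝[(extChartAt (𝓡 4) x₀).symm ⁻¹' S] extChartAt (𝓡 4) x₀ x₀ := by
    have hmap : Filter.map (fun t ↦ -t) (𝓝 (-t₀)) = 𝓝 t₀ := by
      simpa using (Homeomorph.neg ℝ).map_nhds_eq (-t₀)
    rw [← hS, ← hmap, Filter.map_map]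
    rfl
  exact g.eventually_existsUnique_isDirectedLightRay (hF.mono fun _ hy ↦ hy.neg) (by simpa) hβ' hS'

theorem exists_hasStrictDerivAt_extChartAt_comp {I : Set ℝ} {γ : ℝ → M} {t₀ : ℝ} (hI : I ∈ 𝓝 t₀)
    (hγ : ContMDiffAt 𝓘(ℝ, ℝ) (𝓡 4) 1 γ t₀) :
    ∃ T : 𝔼, HasStrictDerivAt (fun t ↦ extChartAt (𝓡 4) (γ t₀) (γ t)) T t₀ ∧
      velocity γ I t₀ = chartSymmDeriv (γ t₀) (extChartAt (𝓡 4) (γ t₀) (γ t₀)) T := by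
  have hβ : ContDiffAt ℝ 1 (fun t ↦ extChartAt (𝓡 4) (γ t₀) (γ t)) t₀ :=
    ((contMDiffAt_extChartAt (n := 1)).comp t₀ hγ).contDiffAt
  have hderiv := hβ.hasStrictDerivAt one_ne_zero
  exact ⟨_, hderiv, velocity_eq_chartSymmDeriv hγ.continuousAt.continuousWithinAt
    (mem_of_mem_nhds hI) (uniqueDiffWithinAt_of_mem_nhds hI) (mem_extChartAt_source (γ t₀))
    hderiv.hasDerivAt.hasDerivWithinAt⟩

end Clock

theorem proposition1_general {M : Type*} [TopologicalSpace M]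
    [ChartedSpace (EuclideanSpace ℝ (Fin 4)) M] [IsManifold (𝓡 4) ∞ M]
    (g : LorentzMetric M) (τ : TimeOrientation g) (I : Set ℝ) (γ : ℝ → M) (t₀ : ℝ)
    (ht₀ : t₀ ∈ interior I) (hI : Topology.IsInducing fun t : I ↦ γ t)
    (hγ : ContMDiffAt 𝓘(ℝ, ℝ) (𝓡 4) 1 γ t₀) (htime : g.Timelike (velocity γ I t₀))
    (hfuture : τ.FuturePointing (velocity γ I t₀)) :
    ∃ U V : Set M, IsOpen U ∧ IsOpen V ∧ γ t₀ ∈ U ∧ U ⊆ V ∧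
      ∀ q ∈ U \ γ '' I,
        (∃ c : ℝ → M, τ.IsFutureLightRay V q (γ '' I) c ∧
          ∀ c' : ℝ → M, τ.IsFutureLightRay V q (γ '' I) c' → EqOn c' c (Icc 0 1)) ∧
        (∃ c : ℝ → M, τ.IsPastLightRay V q (γ '' I) c ∧
          ∀ c' : ℝ → M, τ.IsPastLightRay V q (γ '' I) c' → EqOn c' c (Icc 0 1)) := by
  rw [mem_interior_iff_mem_nhds] at ht₀
  obtain ⟨T, hβ, hvel⟩ := exists_hasStrictDerivAt_extChartAt_comp ht₀ hγ
  rw [hvel] at htime hfuture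
  have hT : g.chartMetric (γ t₀) (extChartAt (𝓡 4) (γ t₀) (γ t₀)) T T < 0 := by
    rw [← g.form_chartSymmDeriv (mem_extChartAt_source (γ t₀))]
    exact htime
  have hcone := TimeOrientation.eventually_isCausalConeAt hT hfuture
  have hS := map_extChartAt_comp_of_isInducing hI ht₀
  obtain ⟨r, ⟨hfut, hpast⟩, hr⟩ :=
    (((g.eventually_existsUnique_isDirectedLightRay hcone hT hβ hS).and
      (g.eventually_existsUnique_isDirectedLightRay_neg hcone hT hβ hS)).and
      self_mem_nhdsWithin).exists
  obtain ⟨U, hU, hUo, hpU⟩ := mem_nhds_iff.1 (hfut.and hpast)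
  refine ⟨U ∩ chartBall (γ t₀) r, chartBall (γ t₀) r, hUo.inter (isOpen_chartBall _ _),
    isOpen_chartBall _ _, ⟨hpU, mem_chartBall_self _ hr⟩, inter_subset_right, ?_⟩
  rintro q ⟨⟨hqU, -⟩, hqS⟩
  exact ⟨(hU hqU).1 hqS, (hU hqU).2 hqS⟩

end

theorem proposition1 {M : Type*} [TopologicalSpace M] [T2Space M]
    [ChartedSpace (EuclideanSpace ℝ (Fin 4)) M] [IsManifold (𝓡 4) ∞ M]
    (g : LorentzMetric M) (τ : TimeOrientation g)
    (I : Set ℝ) (γ : ℝ → M) (hγ : IsClock τ I γ) (t₀ : ℝ) (ht₀ : t₀ ∈ interior I) :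
    ∃ U V : Set M, IsOpen U ∧ IsOpen V ∧ γ t₀ ∈ U ∧ U ⊆ V ∧
      ∀ q ∈ U \ γ '' I,
        (∃ c : ℝ → M, τ.IsFutureLightRay V q (γ '' I) c ∧
          ∀ c' : ℝ → M, τ.IsFutureLightRay V q (γ '' I) c' → Set.EqOn c' c (Set.Icc 0 1)) ∧
        (∃ c : ℝ → M, τ.IsPastLightRay V q (γ '' I) c ∧
          ∀ c' : ℝ → M, τ.IsPastLightRay V q (γ '' I) c' → Set.EqOn c' c (Set.Icc 0 1)) :=
  have ht₀I : t₀ ∈ I := interior_subset ht₀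
  proposition1_general g τ I γ t₀ ht₀ hγ.embedding.isInducing
    (((hγ.smooth t₀ ht₀I).contMDiffAt (mem_interior_iff_mem_nhds.1 ht₀)).of_le ENat.LEInfty.out)
    (hγ.timelike t₀ ht₀I) (hγ.futurePointing t₀ ht₀I)
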